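/- **Conventions.** All systems are finite-dimensional and nonzero, with fixed orthonormal bases; $B'$ is a copy of $B$. $\mathrm{Ad}_M(K)=MKM^\dagger$, channels are completely positive trace-preserving maps, and $\|\Phi\|_\diamond=\sup_n\|\mathrm{id}_n\otimes\Phi\|_{1\to1}$. For a unitary $W$ on $B\otimes B'$ the generalized transposition of a linear map $\mathcal N$ on operators on $B$ is $$\mathcal N^{T[W]}(\sigma)=\mathrm{Tr}_{B'}\big[(\mathbb 1_B\otimes\sigma^T)\,W J W^\dagger\big],\qquad J=\sum_{i,j}\mathcal N(|i\rangle\langle j|)\otimes|i\rangle\langle j| ,$$ so that $T[W]$ with $W$ the swap is the ordinary transposition. A supermap is a superchannel if it sends channels to channels even when applied to a part of a multipartite channel. A channel $\mathcal U$ on $AB$ is compatible with $T_B[W]=\mathrm{id}_A\otimes T[W]$ if $\mathcal U^{T_B[W]}$ is again a channel. A state $\sigma$ of $B$ is compatible with $T_B[W]$ if $\mathcal N\mapsto \mathcal N^{T[W^\dagger]}(\sigma)$ is a superchannel. For a channel $\mathcal M$ on $AB$ and a state $\sigma$ of $B$ put $$\mathcal L_{B\langle A}(\mathcal M|\sigma)=\tfrac12\min_{\tau}\big\|\mathrm{Tr}_A[\mathcal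 M(\,\cdot\otimes\sigma)]-\mathcal E_\tau\big\|_\diamond,\qquad \mathcal E_\tau(\rho)=\tau\,\mathrm{Tr}\rho ,$$ with $\tau$ ranging over the states of $B$, and for a channel $\mathcal N$ on $BB'$ put $$\Xi(\mathcal N)=\tfrac12\min_{u,v}\big\|\mathcal N-\mathrm{Ad}_{u\otimes v}\circ\mathrm{Ad}_F\big\|_\diamond ,$$ with $u,v$ ranging over the unitaries on $B$ and $B'$ and $F$ the swap operator. **Proposition.** Let $\mathcal U$ be a channel on $AB$ and $W$ a unitary on $B\otimes B'$. If $\mathcal U$ is compatible with $T_B[W]$, then $$\max_{\sigma}\ \mathcal L_{B\langle A}(\mathcal U|\sigma)\ \le\ \Xi(\mathrm{Ad}_W),$$ where $\sigma$ ranges over the states of $B$ that are compatible with $T_B[W]$; in particular the maximum exists. Likewise, if $\mathcal U$ is compatible with $T_B[W^\dagger]$, then the maximum of $\mathcal L_{B\langle A}(\mathcal U|\sigma)$ over the states $\sigma$ compatible with $T_B[W^\dagger]$ exists and is at most $\Xi(\mathrm{Ad}_W)$. -/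

import Mathlib

open Matrix
open scoped Kronecker ComplexOrder

noncomputable section

namespace GenTransp

/-- `L(X, Y)`: linear maps from operators on the system with basis `a` to operators on the system
with basis `b`. -/
abbrev OpMap (a b : Type*) := Matrix a a ℂ →ₗ[ℂ] Matrix b b ℂ

section Basic

variable {a b r : Type*}

/-- `ρ` is a quantum state (density matrix). -/
def IsState [Fintype a] (ρ : Matrix a a ℂ) : Prop :=
  ρ.PosSemidef ∧ ρ.trace = 1

/-- The Schatten 1-norm: the sum of the singular values of `M`. -/
def traceNorm [Fintype a] [DecidableEq a] (M : Matrix a a ℂ) : ℝ :=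
  ∑ i, Real.sqrt ((isHermitian_conjTranspose_mul_self M).eigenvalues i)

/-- `id_r ⊗ Φ`, acting blockwise. -/
def ampliate (r : Type*) (Φ : OpMap a b) : OpMap (r × a) (r × b) where
  toFun X := Matrix.of fun p q => Φ (X.submatrix (Prod.mk p.1) (Prod.mk q.1)) p.2 q.2
  map_add' X Y := by
    ext p q
    simp only [Matrix.of_apply, Matrix.submatrix_add, Pi.add_apply, map_add, Matrix.add_apply]
  map_smul' c X := by
    ext p q
    simp only [Matrix.of_apply, Matrix.submatrix_smul, Pi.smul_apply, map_smul, Matrix.smul_apply,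
      RingHom.id_apply]

/-- Complete positivity. -/
def IsCP [Fintype a] [Fintype b] (Φ : OpMap a b) : Prop :=
  ∀ (n : ℕ) (X : Matrix (Fin n × a) (Fin n × a) ℂ),
    X.PosSemidef → (ampliate (Fin n) Φ X).PosSemidef

/-- Trace preservation. -/
def IsTP [Fintype a] [Fintype b] (Φ : OpMap a b) : Prop :=
  ∀ X, (Φ X).trace = X.trace

/-- A quantum channel: a completely positive trace preserving map. -/
def IsChannel [Fintype a] [Fintype b] (Φ : OpMap a b) : Prop :=
  IsCP Φ ∧ IsTP Φ

/-- The diamond norm `sup_n ‖id_n ⊗ Φ‖_{1 → 1}`. -/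
def diamondNorm [Fintype a] [Fintype b] [DecidableEq a] [DecidableEq b] (Φ : OpMap a b) : ℝ :=
  sSup {t | ∃ (n : ℕ) (X : Matrix (Fin n × a) (Fin n × a) ℂ),
    traceNorm X ≤ 1 ∧ t = traceNorm (ampliate (Fin n) Φ X)}

/-- `Ad_M (K) = M K M†`. -/
def Ad [Fintype a] (M : Matrix a a ℂ) : OpMap a a where
  toFun K := M * K * Mᴴ
  map_add' X Y := by rw [Matrix.mul_add, Matrix.add_mul]
  map_smul' c X := by rw [Matrix.mul_smul, Matrix.smul_mul, RingHom.id_apply]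

/-- The swap operator `F = ∑ᵢⱼ |i⟩⟨j| ⊗ |j⟩⟨i|`. -/
def swapOp (b : Type*) [DecidableEq b] : Matrix (b × b) (b × b) ℂ :=
  Matrix.of fun p q => if p.1 = q.2 ∧ p.2 = q.1 then 1 else 0

end Basic

section Supermaps

variable {a b c d r s : Type*}

/-- The component `X ↦ ⟨k| N(|i⟩⟨j| ⊗ X) |l⟩` of a map `N` on a composite system. -/
def component [DecidableEq r] (N : OpMap (r × a) (s × b)) (i j : r) (k l : s) : OpMap a b where
  toFun X := Matrix.of fun x y => N (Matrix.single i j (1 : ℂ) ⊗ₖ X) (k, x) (l, y)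
  map_add' X Y := by
    ext x y
    simp only [Matrix.kronecker_add, map_add, Matrix.of_apply, Matrix.add_apply]
  map_smul' z X := by
    ext x y
    simp only [Matrix.kronecker_smul, map_smul, Matrix.of_apply, Matrix.smul_apply,
      RingHom.id_apply]

/-- `(id ⊗ Θ)(N)`: the supermap `Θ : L(a, b) → L(c, d)` applied to a part of a map
`N ∈ L(r ⊗ a, s ⊗ b)`; it sends `E ⊗ G` to `E ⊗ Θ(G)`. -/
def applyPart [Fintype r] [DecidableEq r] (Θ : OpMap a b →ₗ[ℂ] OpMap c d)
    (N : OpMap (r × a) (s × b)) : OpMap (r × c) (s × d) where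
  toFun Y := Matrix.of fun p q => ∑ i, ∑ j,
    Θ (component N i j p.1 q.1) (Y.submatrix (Prod.mk i) (Prod.mk j)) p.2 q.2
  map_add' X Y := by
    ext p q
    simp only [Matrix.of_apply, Matrix.submatrix_add, Pi.add_apply, map_add, Matrix.add_apply,
      Finset.sum_add_distrib]
  map_smul' z X := by
    ext p q
    simp only [Matrix.of_apply, Matrix.submatrix_smul, Pi.smul_apply, map_smul, Matrix.smul_apply,
      RingHom.id_apply, Finset.smul_sum]

/-- A superchannel: a supermap that sends quantum channels to quantum channels, even when it acts
only on a part of a multipartite channel. -/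
def IsSuperchannel [Fintype a] [Fintype b] [Fintype c] [Fintype d]
    (Θ : OpMap a b →ₗ[ℂ] OpMap c d) : Prop :=
  ∀ (m n : ℕ) (N : OpMap (Fin m × a) (Fin n × b)), IsChannel N → IsChannel (applyPart Θ N)

/-- The unnormalized Choi matrix `∑ᵢⱼ N(|i⟩⟨j|) ⊗ |i⟩⟨j|`. -/
def choi [DecidableEq b] : OpMap b b →ₗ[ℂ] Matrix (b × b) (b × b) ℂ where
  toFun N := Matrix.of fun p q => N (Matrix.single p.2 q.2 1) p.1 q.1
  map_add' M N := by
    ext p q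
    simp only [LinearMap.add_apply, Matrix.of_apply, Matrix.add_apply]
  map_smul' z N := by
    ext p q
    simp only [LinearMap.smul_apply, Matrix.of_apply, Matrix.smul_apply, RingHom.id_apply]

/-- The map `σ ↦ Tr₂[(1 ⊗ σᵀ) J]` with unnormalized Choi matrix `J`. -/
def ofChoi [Fintype b] : Matrix (b × b) (b × b) ℂ →ₗ[ℂ] OpMap b b where
  toFun J :=
    { toFun := fun σ => Matrix.of fun x y => ∑ i, ∑ j, J (x, i) (y, j) * σ i j
      map_add' := by
        intro X Y
        ext x y
        simp only [Matrix.of_apply, Matrix.add_apply, mul_add, Finset.sum_add_distrib]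
      map_smul' := by
        intro z X
        ext x y
        simp only [Matrix.of_apply, Matrix.smul_apply, smul_eq_mul, Finset.mul_sum,
          RingHom.id_apply, mul_left_comm] }
  map_add' J K := by
    ext1 X
    ext x y
    simp only [LinearMap.coe_mk, AddHom.coe_mk, LinearMap.add_apply, Matrix.of_apply,
      Matrix.add_apply, add_mul, Finset.sum_add_distrib]
  map_smul' z J := by
    ext1 X
    ext x y
    simp only [LinearMap.coe_mk, AddHom.coe_mk, LinearMap.smul_apply, Matrix.of_apply,
      Matrix.smul_apply, smul_eq_mul, Finset.mul_sum, RingHom.id_apply, mul_assoc]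

/-- The generalized transposition of maps,
`T[W](N)(σ) = |B|² Tr_{BA'}[(1_A ⊗ φ⁺_{BA'}) (Ad_W(J^N_{AB}) ⊗ σ_{A'})]`, where `J^N` is the Choi
matrix with respect to the maximally entangled state `φ⁺`. The factor `|B|²` cancels the
normalizations of the two copies of `φ⁺`, which leaves `Tr_B[(1_A ⊗ σᵀ) Ad_W(|B| J^N)]`. -/
def genTranspose [Fintype b] [DecidableEq b] (W : Matrix (b × b) (b × b) ℂ) :
    OpMap b b →ₗ[ℂ] OpMap b b :=
  ofChoi ∘ₗ Ad W ∘ₗ choi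

/-- The channel `U` on `A ⊗ B` is compatible with `T_B[W]`:
`(id_A ⊗ T[W])(U)` is also a channel. -/
def IsCompatible [Fintype a] [Fintype b] [DecidableEq a] [DecidableEq b]
    (W : Matrix (b × b) (b × b) ℂ) (U : OpMap (a × b) (a × b)) : Prop :=
  IsChannel (applyPart (genTranspose W) U)

/-- The state preparation supermap `N ↦ N(σ)`; its value, an operator on `b`, is regarded as a map
from the trivial system. -/
def prep (σ : Matrix b b ℂ) : OpMap b b →ₗ[ℂ] OpMap Unit b where
  toFun N :=
    { toFun := fun Y => Y () () • N σ
      map_add' := fun X Y => by rw [Matrix.add_apply, add_smul]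
      map_smul' := fun z X => by
        rw [Matrix.smul_apply, smul_eq_mul, mul_smul, RingHom.id_apply] }
  map_add' M N := by
    ext1 Y
    simp only [LinearMap.coe_mk, AddHom.coe_mk, LinearMap.add_apply, smul_add]
  map_smul' z N := by
    ext1 Y
    simp only [LinearMap.coe_mk, AddHom.coe_mk, LinearMap.smul_apply, RingHom.id_apply,
      smul_comm z]

/-- The preparation of `σ` is compatible with the generalized transposition `T[W]` of its input
channel: `N ↦ T[W†](N)(σ)` is a superchannel. -/
def PrepCompatible [Fintype b] [DecidableEq b] (W : Matrix (b × b) (b × b) ℂ)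
    (σ : Matrix b b ℂ) : Prop :=
  IsSuperchannel (prep σ ∘ₗ genTranspose Wᴴ)

end Supermaps

section Measures

variable {a b : Type*} [Fintype a] [Fintype b] [DecidableEq a] [DecidableEq b]

/-- The initialization map `ρ ↦ Tr[ρ] τ`. -/
def initMap (a : Type*) [Fintype a] {b : Type*} (τ : Matrix b b ℂ) : OpMap a b where
  toFun ρ := ρ.trace • τ
  map_add' X Y := by rw [Matrix.trace_add, add_smul]
  map_smul' z X := by rw [Matrix.trace_smul, smul_eq_mul, mul_smul, RingHom.id_apply]

/-- The geometric capacity: half the diamond distance from `N` to the initialization maps. -/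
def geomCapacity (N : OpMap a b) : ℝ :=
  (1 / 2) * ⨅ τ : {τ : Matrix b b ℂ // IsState τ}, diamondNorm (N - initMap a τ.1)

/-- The map `ρ ↦ Tr_A[M(ρ ⊗ σ)]`. -/
def reducedMap (M : OpMap (a × b) (a × b)) (σ : Matrix b b ℂ) : OpMap a b where
  toFun ρ := Matrix.of fun x y => ∑ i, M (ρ ⊗ₖ σ) (i, x) (i, y)
  map_add' X Y := by
    ext x y
    simp only [Matrix.add_kronecker, map_add, Matrix.of_apply, Matrix.add_apply,
      Finset.sum_add_distrib]
  map_smul' z X := by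
    ext x y
    simp only [Matrix.smul_kronecker, map_smul, Matrix.of_apply, Matrix.smul_apply,
      Finset.smul_sum, RingHom.id_apply]

/-- The information leakage from `A` to `B` through `M` when `B` is prepared in `σ`. -/
def leakage (M : OpMap (a × b) (a × b)) (σ : Matrix b b ℂ) : ℝ :=
  geomCapacity (reducedMap M σ)

/-- The non-swappability: half the diamond distance from `N` to the swap followed by local
unitary operations. -/
def nonSwappability (N : OpMap (b × b) (b × b)) : ℝ :=
  (1 / 2) * ⨅ u : unitaryGroup b ℂ × unitaryGroup b ℂ,
    diamondNorm (N - Ad ((u.1 : Matrix b b ℂ) ⊗ₖ (u.2 : Matrix b b ℂ)) ∘ₗ Ad (swapOp b))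

end Measures

end GenTransp

end

set_option linter.unusedSectionVars false

/-! Write V for the channel `applyPart (genTranspose W) U`. On Choi matrices T[W] is conjugation by
W, so T[W†] undoes it and U is recovered from V. Leakage through U with σ prepared is then a
statement about V followed by the supermap N ↦ T[W†](N)(σ).

Trace preservation of that supermap forces W(1 ⊗ σᵀ)W† = 1 ⊗ ω for a state ω
(`PrepCompatible.exists_eq`, `eq_one_kronecker_of_trace_eq_one`), and by uniqueness of positive
square roots W intertwines 1 ⊗ t with 1 ⊗ u, where t² = σᵀ and u² = ω (`exists_intertwined_sqrt`).
Hence T[W†](N)(σ) = Tr_{B'}[W†(1 ⊗ u)J(1 ⊗ u)W], and (1 ⊗ u)J(1 ⊗ u) is the output of N on half of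
the pure state with coefficient matrix u. So the reduced map A → B of U is Tr_{B'} ∘ Ad_{W†} ∘ Λ
with Λ a channel.

If Ad_{W†} is replaced by a swap followed by local unitaries, the partial trace keeps only the
reference half of the pure state, which carries nothing about the input: the result is an
initialization map. Contractivity of the diamond distance under pre- and post-processing bounds the
leakage by Ξ(Ad_{W†}), and Ξ(Ad_{W†}) ≤ Ξ(Ad_W) (`nonSwappability_Ad_conjTranspose_le`).

The maximum exists because the compatible states form a nonempty compact set on which the leakage is
continuous. -/

namespace GenTransp

/-! ### The trace norm through positive 2 × 2 block matrices -/

section TraceNorm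

variable {a b c : Type*} [Fintype a] [DecidableEq a] [Fintype b] [DecidableEq b]

/-- The absolute value of a matrix and its pseudo-inverse. -/
theorem exists_abs_pinv (X : Matrix a a ℂ) :
    ∃ A B : Matrix a a ℂ, A.PosSemidef ∧ B.IsHermitian ∧ A * A = Xᴴ * X ∧ A * B = B * A ∧
      A * B * A = A ∧ B * A * B = B ∧ A.trace = traceNorm X := by
  set hX := isHermitian_conjTranspose_mul_self X
  set V : Matrix a a ℂ := (hX.eigenvectorUnitary : Matrix a a ℂ) with hV
  set d : a → ℝ := fun i => Real.sqrt (hX.eigenvalues i) with hd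
  have hVV : Vᴴ * V = 1 := by
    have := Unitary.coe_star_mul_self hX.eigenvectorUnitary
    simpa [star_eq_conjTranspose] using this
  have hsp : Xᴴ * X = V * diagonal (fun i => (hX.eigenvalues i : ℂ)) * Vᴴ := by
    have := hX.spectral_theorem
    rw [Unitary.conjStarAlgAut_apply] at this
    exact this
  have hmul : ∀ f g : a → ℂ, (V * diagonal f * Vᴴ) * (V * diagonal g * Vᴴ)
      = V * diagonal (fun i => f i * g i) * Vᴴ := by
    intro f g
    calc _ = V * diagonal f * (Vᴴ * V) * diagonal g * Vᴴ := by simp only [Matrix.mul_assoc]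
      _ = _ := by rw [hVV, Matrix.mul_one, Matrix.mul_assoc V, diagonal_mul_diagonal]
  -- Since 0⁻¹ = 0, inverting the singular values entrywise yields the pseudo-inverse.
  refine ⟨V * diagonal (fun i => (d i : ℂ)) * Vᴴ, V * diagonal (fun i => (d i : ℂ)⁻¹) * Vᴴ,
    ?_, ?_, ?_, ?_, ?_, ?_, ?_⟩
  · refine (PosSemidef.diagonal ?_).mul_mul_conjTranspose_same V
    intro i
    simp [hd]
  · refine isHermitian_mul_mul_conjTranspose _ ?_
    rw [IsHermitian, diagonal_conjTranspose]
    congr 1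
    ext i
    simp
  · rw [hmul, hsp]
    congr 3
    ext i
    rw [← Complex.ofReal_mul, hd]
    simp only
    rw [Real.mul_self_sqrt (eigenvalues_conjTranspose_mul_self_nonneg X i)]
  · rw [hmul, hmul]
    simp only [mul_comm]
  · rw [hmul, hmul]
    congr 3
    ext i
    exact mul_inv_mul_cancel _
  · rw [hmul, hmul]
    congr 3
    ext i
    simpa using mul_inv_mul_cancel (d i : ℂ)⁻¹
  · rw [trace_mul_comm, ← Matrix.mul_assoc, hVV, Matrix.one_mul, trace_diagonal, traceNorm]
    push_cast
    rfl

/-- Congruence of |X| by the column (X|X|⁻¹, 1), with the pseudo-inverse, has X as off-diagonal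
block. With the next bound this is a variational formula for the trace norm, from which all its
needed inequalities follow. -/
theorem exists_posSemidef_fromBlocks (X : Matrix a a ℂ) :
    ∃ P Q : Matrix a a ℂ, (fromBlocks P X Xᴴ Q).PosSemidef ∧ P.trace = traceNorm X ∧
      Q.trace = traceNorm X := by
  obtain ⟨A, B, hA, hB, hAA, hc, hABA, hBAB, htr⟩ := exists_abs_pinv X
  -- B A is the projection onto the support of |X|, on which X lives.
  have hXE : X * B * A = X := by
    have h : (X - X * B * A)ᴴ * (X - X * B * A) = 0 := by
      rw [conjTranspose_sub, conjTranspose_mul, conjTranspose_mul, hB.eq, hA.1.eq]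
      have e1 : (Xᴴ - A * (B * Xᴴ)) * (X - X * B * A)
          = Xᴴ * X - (Xᴴ * X) * B * A - A * B * (Xᴴ * X) + A * B * (Xᴴ * X) * B * A := by
        noncomm_ring
      rw [e1, ← hAA]
      have e2 : A * A * B * A = A * A := by rw [Matrix.mul_assoc A A B, Matrix.mul_assoc, hABA]
      have e3 : A * B * (A * A) = A * A := by rw [← Matrix.mul_assoc, hABA]
      rw [e3, e2]
      abel
    have := Matrix.conjTranspose_mul_self_eq_zero.mp h
    exact (sub_eq_zero.mp this).symm
  refine ⟨X * B * Xᴴ, A, ?_, ?_, htr⟩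
  · have h := hA.mul_mul_conjTranspose_same (fromRows (X * B) (1 : Matrix a a ℂ))
    rw [conjTranspose_fromRows_eq_fromCols_conjTranspose, fromRows_mul, fromRows_mul_fromCols,
      conjTranspose_one, Matrix.one_mul, Matrix.mul_one, Matrix.mul_one, conjTranspose_mul, hB.eq,
      hXE, ← Matrix.mul_assoc X B, ← Matrix.mul_assoc A B] at h
    convert h using 2
    conv_lhs => rw [← hXE]
    rw [conjTranspose_mul, conjTranspose_mul, hB.eq, hA.1.eq, Matrix.mul_assoc]
  · rw [Matrix.mul_assoc, trace_mul_comm, Matrix.mul_assoc, ← hAA, ← htr,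
      ← Matrix.mul_assoc, ← hc, hABA]

theorem trace_mul_re_le {P C : Matrix a a ℂ} (hP : P.PosSemidef) (hC : (1 - C).PosSemidef) :
    (P * C).trace.re ≤ P.trace.re := by
  have h : 0 ≤ ((P * (1 - C)).trace).re := by
    obtain ⟨R, rfl⟩ : ∃ R : Matrix a a ℂ, P = Rᴴ * R := by
      open scoped MatrixOrder in
      exact CStarAlgebra.nonneg_iff_eq_star_mul_self.mp hP.nonneg
    rw [Matrix.mul_assoc, trace_mul_comm]
    have := (hC.mul_mul_conjTranspose_same R).trace_nonneg
    exact (Complex.le_def.mp this).1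
  rw [Matrix.mul_sub, Matrix.mul_one, trace_sub, Complex.sub_re] at h
  linarith

/-- The polar partial isometry Z = |X|⁻¹X† satisfies ZX = |X|. Compressing the block matrix by (Z,
−1) gives 0 ≤ Tr ZPZ† − 2 Tr|X| + Tr Q, and Tr ZPZ† ≤ Tr P as Z is a contraction. -/
theorem traceNorm_le_of_fromBlocks {P X Y Q : Matrix a a ℂ}
    (h : (fromBlocks P X Y Q).PosSemidef) :
    traceNorm X ≤ (P.trace.re + Q.trace.re) / 2 := by
  obtain ⟨A, B, hA, hB, hAA, hc, hABA, hBAB, htr⟩ := exists_abs_pinv X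
  obtain ⟨hPh, hXY, -, -⟩ := isHermitian_fromBlocks_iff.mp h.1
  have hP : P.PosSemidef := h.submatrix Sum.inl
  obtain ⟨Z, hZ⟩ : ∃ Z, Z = B * Xᴴ := ⟨_, rfl⟩
  have hZX : Z * X = A := by
    rw [hZ, Matrix.mul_assoc, ← hAA, ← Matrix.mul_assoc, ← hc, hABA]
  have hZZ : Z * Zᴴ = A * B := by
    rw [hZ, conjTranspose_mul, conjTranspose_conjTranspose, hB.eq, Matrix.mul_assoc,
      ← Matrix.mul_assoc Xᴴ, ← hAA, ← Matrix.mul_assoc, ← Matrix.mul_assoc, ← hc, hABA]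
  have hEZ : A * B * Z = Z := by
    rw [hZ, ← Matrix.mul_assoc, hc, hBAB]
  -- ZZ†Z = Z, so 1 − Z†Z is a Hermitian idempotent.
  have hcontr : (1 - Zᴴ * Z).PosSemidef := by
    have e : (1 - Zᴴ * Z)ᴴ * (1 - Zᴴ * Z) = 1 - Zᴴ * Z := by
      rw [conjTranspose_sub, conjTranspose_one, conjTranspose_mul, conjTranspose_conjTranspose]
      have : (1 - Zᴴ * Z) * (1 - Zᴴ * Z) = 1 - Zᴴ * Z - Zᴴ * Z + Zᴴ * (Z * Zᴴ * Z) := by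
        noncomm_ring
      rw [this, hZZ, hEZ]
      abel
    rw [← e]
    exact posSemidef_conjTranspose_mul_self _
  have hpos := (h.mul_mul_conjTranspose_same (fromCols Z (-1 : Matrix a a ℂ))).trace_nonneg
  have key : (fromCols Z (-1 : Matrix a a ℂ) * fromBlocks P X Y Q * (fromCols Z (-1 : Matrix a a ℂ))ᴴ)
      = Z * P * Zᴴ - A - Aᴴ + Q := by
    rw [conjTranspose_fromCols_eq_fromRows_conjTranspose, fromCols_mul_fromBlocks,
      fromCols_mul_fromRows, ← hZX, conjTranspose_mul, ← hXY]
    simp only [conjTranspose_neg, conjTranspose_one]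
    noncomm_ring
  rw [key] at hpos
  have hre := (Complex.le_def.mp hpos).1
  rw [hA.1.eq] at hre
  simp only [trace_add, trace_sub, htr, Complex.add_re, Complex.sub_re, Complex.ofReal_re,
    Complex.zero_re] at hre
  have h2 : (Z * P * Zᴴ).trace = (P * (Zᴴ * Z)).trace := by
    rw [Matrix.mul_assoc, trace_mul_comm, Matrix.mul_assoc]
  rw [h2] at hre
  have := trace_mul_re_le hP hcontr
  linarith

theorem traceNorm_nonneg (X : Matrix a a ℂ) : 0 ≤ traceNorm X :=
  Finset.sum_nonneg fun _ _ => Real.sqrt_nonneg _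

theorem traceNorm_add_le (X Y : Matrix a a ℂ) :
    traceNorm (X + Y) ≤ traceNorm X + traceNorm Y := by
  obtain ⟨P, Q, h, hP, hQ⟩ := exists_posSemidef_fromBlocks X
  obtain ⟨P', Q', h', hP', hQ'⟩ := exists_posSemidef_fromBlocks Y
  have := h.add h'
  rw [fromBlocks_add] at this
  refine (traceNorm_le_of_fromBlocks this).trans (le_of_eq ?_)
  simp only [trace_add, hP, hQ, hP', hQ', Complex.add_re, Complex.ofReal_re]
  ring

theorem traceNorm_neg (X : Matrix a a ℂ) : traceNorm (-X) = traceNorm X := by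
  unfold traceNorm
  simp only [conjTranspose_neg, neg_mul_neg]

theorem traceNorm_sub_le (X Y : Matrix a a ℂ) :
    traceNorm (X - Y) ≤ traceNorm X + traceNorm Y := by
  rw [sub_eq_add_neg, ← traceNorm_neg Y]
  exact traceNorm_add_le _ _

/-- The tensor product of two block certificates contains one for X ⊗ Y as a principal submatrix. -/
theorem traceNorm_kronecker_le (X : Matrix a a ℂ) (Y : Matrix b b ℂ) :
    traceNorm (X ⊗ₖ Y) ≤ traceNorm X * traceNorm Y := by
  obtain ⟨P, Q, h, hP, hQ⟩ := exists_posSemidef_fromBlocks X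
  obtain ⟨P', Q', h', hP', hQ'⟩ := exists_posSemidef_fromBlocks Y
  let f : (a × b) ⊕ (a × b) → (a ⊕ a) × (b ⊕ b) :=
    Sum.elim (fun p => (Sum.inl p.1, Sum.inl p.2)) (fun p => (Sum.inr p.1, Sum.inr p.2))
  have hk := (h.kronecker h').submatrix f
  have e : (fromBlocks P X Xᴴ Q ⊗ₖ fromBlocks P' Y Yᴴ Q').submatrix f f
      = fromBlocks (P ⊗ₖ P') (X ⊗ₖ Y) (Xᴴ ⊗ₖ Yᴴ) (Q ⊗ₖ Q') := by
    ext p q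
    rcases p with p | p <;> rcases q with q | q <;> rfl
  rw [e] at hk
  refine (traceNorm_le_of_fromBlocks hk).trans (le_of_eq ?_)
  simp only [trace_kronecker, hP, hQ, hP', hQ', ← Complex.ofReal_mul, Complex.ofReal_re]
  ring

/-- A crude bound by an expression visibly continuous in X; it is used only for continuity of the
leakage. -/
theorem traceNorm_le_card_mul_sqrt (X : Matrix a a ℂ) :
    traceNorm X ≤ Fintype.card a * Real.sqrt (Xᴴ * X).trace.re := by
  have hX := isHermitian_conjTranspose_mul_self X
  have hn := eigenvalues_conjTranspose_mul_self_nonneg X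
  have htr : (Xᴴ * X).trace.re = ∑ i, hX.eigenvalues i := by
    rw [hX.trace_eq_sum_eigenvalues]
    simp
  unfold traceNorm
  calc _ ≤ ∑ _i : a, Real.sqrt (Xᴴ * X).trace.re := by
        refine Finset.sum_le_sum fun i _ => Real.sqrt_le_sqrt ?_
        rw [htr]
        exact Finset.single_le_sum (f := hX.eigenvalues) (fun j _ => hn j) (Finset.mem_univ i)
    _ = _ := by simp

end TraceNorm

/-! ### Channels and the diamond distance -/

section Channels

variable {a b c d r s : Type*}

theorem ampliate_apply (Φ : OpMap a b) (X : Matrix (r × a) (r × a) ℂ) (p q : r × b) :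
    ampliate r Φ X p q = Φ (X.submatrix (Prod.mk p.1) (Prod.mk q.1)) p.2 q.2 := rfl

theorem ampliate_comp (Φ : OpMap b c) (Ψ : OpMap a b) :
    ampliate r (Φ ∘ₗ Ψ) = ampliate r Φ ∘ₗ ampliate r Ψ := rfl

theorem ampliate_sub (Φ Ψ : OpMap a b) :
    ampliate r (Φ - Ψ) = ampliate r Φ - ampliate r Ψ := by
  ext1 X
  ext p q
  rfl

theorem ampliate_add (Φ Ψ : OpMap a b) :
    ampliate r (Φ + Ψ) = ampliate r Φ + ampliate r Ψ := by
  ext1 X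
  ext p q
  rfl

theorem ampliate_neg (Φ : OpMap a b) : ampliate r (-Φ) = -ampliate r Φ := by
  ext1 X
  ext p q
  rfl

/-- This is congruence by 1 ⊗ (1, …, 1). -/
theorem posSemidef_sum_blocks [Fintype a] [Fintype c] {A : Matrix (a × c) (a × c) ℂ}
    (hA : A.PosSemidef) : (of fun p q => ∑ i, ∑ j, A (p, i) (q, j)).PosSemidef := by
  classical
  have e : (of fun p q => ∑ i, ∑ j, A (p, i) (q, j))
      = (of fun (p : a) (x : a × c) => if x.1 = p then (1 : ℂ) else 0) * A
        * (of fun (p : a) (x : a × c) => if x.1 = p then (1 : ℂ) else 0)ᴴ := by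
    ext p q
    simp [mul_apply, Fintype.sum_prod_type, apply_ite star]
    rw [Finset.sum_comm]
    simp_rw [fun j k => (Finset.sum_comm : ∑ i : a, ∑ l : c,
      (if i = p then A (i, l) (j, k) else 0) = _), Finset.sum_ite_eq', Finset.mem_univ, if_true]
    rw [Finset.sum_comm (s := (Finset.univ : Finset a))]
    simp_rw [Finset.sum_ite_eq', Finset.mem_univ, if_true]
  rw [e]
  exact hA.mul_mul_conjTranspose_same _

theorem posSemidef_traceRight [Fintype c] {A : Matrix (a × c) (a × c) ℂ}
    (hA : A.PosSemidef) : (of fun p q => ∑ i, A (p, i) (q, i)).PosSemidef := by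
  have : (of fun p q => ∑ i, A (p, i) (q, i))
      = ∑ i, A.submatrix (fun p : a => (p, i)) (fun p : a => (p, i)) := by
    ext p q
    simp [Matrix.sum_apply]
  rw [this]
  exact posSemidef_sum _ fun i _ => hA.submatrix _

variable [Fintype a] [Fintype b] [Fintype c] [Fintype d] [Fintype r] [Fintype s]

theorem IsCP.posSemidef_ampliate {Φ : OpMap a b} (hΦ : IsCP Φ) {X : Matrix (r × a) (r × a) ℂ}
    (hX : X.PosSemidef) : (ampliate r Φ X).PosSemidef := by
  let e := Fintype.equivFin r
  have h := (hΦ _ _ (hX.submatrix (Prod.map e.symm id))).submatrix (Prod.map e id)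
  convert h using 1
  ext p q
  simp [ampliate_apply, submatrix_submatrix, Function.comp_def]

theorem IsCP.comp {Φ : OpMap b c} {Ψ : OpMap a b} (hΦ : IsCP Φ) (hΨ : IsCP Ψ) :
    IsCP (Φ ∘ₗ Ψ) := fun n X hX => hΦ n _ (hΨ n X hX)

theorem IsChannel.comp {Φ : OpMap b c} {Ψ : OpMap a b} (hΦ : IsChannel Φ) (hΨ : IsChannel Ψ) :
    IsChannel (Φ ∘ₗ Ψ) := ⟨hΦ.1.comp hΨ.1, fun X => (hΦ.2 _).trans (hΨ.2 X)⟩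

theorem IsCP.ampliate {Φ : OpMap a b} (hΦ : IsCP Φ) : IsCP (ampliate r Φ) := by
  intro n X hX
  have h := (hΦ.posSemidef_ampliate (hX.submatrix (Equiv.prodAssoc (Fin n) r a))).submatrix
    (Equiv.prodAssoc (Fin n) r b).symm
  exact h

theorem IsTP.ampliate {Φ : OpMap a b} (hΦ : IsTP Φ) : IsTP (ampliate r Φ) := by
  intro X
  have h := fun i : r => hΦ (X.submatrix (Prod.mk i) (Prod.mk i))
  simp only [trace, diag_apply, Fintype.sum_prod_type, submatrix_apply] at h ⊢
  exact Finset.sum_congr rfl fun i _ => h i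

theorem IsChannel.ampliate {Φ : OpMap a b} (hΦ : IsChannel Φ) : IsChannel (ampliate r Φ) :=
  ⟨hΦ.1.ampliate, hΦ.2.ampliate⟩

/-- Acting on each block is amplification by a two-level reference, so channels carry trace-norm
certificates to certificates. -/
theorem IsCP.posSemidef_fromBlocks {Φ : OpMap a b} (hΦ : IsCP Φ) {A B C D : Matrix a a ℂ}
    (h : (fromBlocks A B C D).PosSemidef) :
    (fromBlocks (Φ A) (Φ B) (Φ C) (Φ D)).PosSemidef := by
  let f : Bool × a → a ⊕ a := fun p => if p.1 then Sum.inl p.2 else Sum.inr p.2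
  let g : b ⊕ b → Bool × b := Sum.elim (Prod.mk true) (Prod.mk false)
  have h' := (hΦ.posSemidef_ampliate (h.submatrix f)).submatrix g
  convert h' using 1
  ext p q
  rcases p with p | p <;> rcases q with q | q <;> rfl

/-- Channels contract the trace norm. -/
theorem IsChannel.traceNorm_le [DecidableEq a] [DecidableEq b] {Φ : OpMap a b}
    (hΦ : IsChannel Φ) (X : Matrix a a ℂ) : traceNorm (Φ X) ≤ traceNorm X := by
  obtain ⟨P, Q, h, hP, hQ⟩ := exists_posSemidef_fromBlocks X
  refine (traceNorm_le_of_fromBlocks (hΦ.1.posSemidef_fromBlocks h)).trans (le_of_eq ?_)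
  rw [hΦ.2, hΦ.2, hP, hQ, Complex.ofReal_re, add_self_div_two]

variable [DecidableEq a] [DecidableEq b] [DecidableEq c] [DecidableEq d]

theorem diamondNorm_nonneg (Φ : OpMap a b) : 0 ≤ diamondNorm Φ := by
  refine Real.sSup_nonneg ?_
  rintro t ⟨n, X, -, rfl⟩
  exact traceNorm_nonneg _

theorem diamondNorm_le {Φ : OpMap a b} {C : ℝ} (hC : 0 ≤ C)
    (h : ∀ (n : ℕ) (X : Matrix (Fin n × a) (Fin n × a) ℂ), traceNorm X ≤ 1 →
      traceNorm (ampliate (Fin n) Φ X) ≤ C) : diamondNorm Φ ≤ C := by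
  refine Real.sSup_le ?_ hC
  rintro t ⟨n, X, hX, rfl⟩
  exact h n X hX

theorem diamondNorm_neg (Φ : OpMap a b) : diamondNorm (-Φ) = diamondNorm Φ := by
  simp only [diamondNorm, ampliate_neg, LinearMap.neg_apply, traceNorm_neg]

theorem diamondNorm_sub_comm (Φ Ψ : OpMap a b) : diamondNorm (Φ - Ψ) = diamondNorm (Ψ - Φ) := by
  rw [← neg_sub, diamondNorm_neg]

theorem traceNorm_ampliate_sub_le_diamondNorm {Φ Ψ : OpMap a b} (hΦ : IsChannel Φ)
    (hΨ : IsChannel Ψ) {n : ℕ} {X : Matrix (Fin n × a) (Fin n × a) ℂ} (hX : traceNorm X ≤ 1) :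
    traceNorm (ampliate (Fin n) (Φ - Ψ) X) ≤ diamondNorm (Φ - Ψ) := by
  -- The real supremum is meaningful only for a bounded set; two channels differ by at most 2.
  refine le_csSup ⟨1 + 1, ?_⟩ ⟨n, X, hX, rfl⟩
  rintro t ⟨n, X, hX, rfl⟩
  rw [ampliate_sub, LinearMap.sub_apply]
  exact (traceNorm_sub_le _ _).trans
    (add_le_add ((hΦ.ampliate.traceNorm_le X).trans hX) ((hΨ.ampliate.traceNorm_le X).trans hX))

/-- Pre- and post-processing by channels does not increase the diamond distance. -/
theorem diamondNorm_comp_sub_comp_le {Θ : OpMap c d} {Φ Ψ : OpMap b c} {Λ : OpMap a b}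
    (hΘ : IsChannel Θ) (hΦ : IsChannel Φ) (hΨ : IsChannel Ψ) (hΛ : IsChannel Λ) :
    diamondNorm (Θ ∘ₗ (Φ - Ψ) ∘ₗ Λ) ≤ diamondNorm (Φ - Ψ) := by
  refine diamondNorm_le (diamondNorm_nonneg _) fun n X hX => ?_
  rw [ampliate_comp, ampliate_comp]
  exact (hΘ.ampliate.traceNorm_le _).trans (traceNorm_ampliate_sub_le_diamondNorm hΦ hΨ
    ((hΛ.ampliate.traceNorm_le X).trans hX))

theorem Ad_apply (M X : Matrix a a ℂ) : Ad M X = M * X * Mᴴ := rfl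

theorem Ad_mul (M N : Matrix a a ℂ) : Ad (M * N) = Ad M ∘ₗ Ad N := by
  ext1 X
  simp only [Ad_apply, LinearMap.comp_apply, conjTranspose_mul, Matrix.mul_assoc]

theorem ampliate_Ad [DecidableEq r] (M : Matrix a a ℂ) :
    ampliate r (Ad M) = Ad ((1 : Matrix r r ℂ) ⊗ₖ M) := by
  ext1 X
  ext ⟨m, x⟩ ⟨n, y⟩
  simp [ampliate_apply, Ad_apply, mul_apply, Fintype.sum_prod_type, one_apply, Finset.sum_mul,
    conjTranspose_kronecker]

theorem isCP_Ad (M : Matrix a a ℂ) : IsCP (Ad M) := by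
  intro n X hX
  rw [ampliate_Ad]
  exact hX.mul_mul_conjTranspose_same _

theorem isChannel_Ad {W : Matrix a a ℂ} (hW : W ∈ unitaryGroup a ℂ) : IsChannel (Ad W) := by
  refine ⟨isCP_Ad W, fun X => ?_⟩
  have h : Wᴴ * W = 1 := mem_unitaryGroup_iff'.mp hW
  rw [Ad_apply, trace_mul_comm, ← Matrix.mul_assoc, h, Matrix.one_mul]

theorem isChannel_initMap {τ : Matrix b b ℂ} (hτ : IsState τ) : IsChannel (initMap a τ) := by
  refine ⟨fun n X hX => ?_, fun X => ?_⟩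
  · exact (posSemidef_traceRight hX).kronecker hτ.1
  · simp [initMap, hτ.2]

/-- The partial trace over the second factor. -/
def traceRight (a c : Type*) [Fintype c] : OpMap (a × c) a where
  toFun X := of fun x y => ∑ i, X (x, i) (y, i)
  map_add' X Y := by
    ext x y
    simp only [of_apply, Matrix.add_apply, Finset.sum_add_distrib]
  map_smul' z X := by
    ext x y
    simp only [of_apply, Matrix.smul_apply, Finset.smul_sum, RingHom.id_apply]

theorem isChannel_traceRight : IsChannel (traceRight a c) := by
  refine ⟨fun n X hX => ?_, fun X => ?_⟩
  · exact posSemidef_traceRight (hX.submatrix (Equiv.prodAssoc (Fin n) a c))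
  · simp [traceRight, trace, Fintype.sum_prod_type]

/-- The partial trace over the first factor. -/
def traceLeft (c a : Type*) [Fintype c] : OpMap (c × a) a where
  toFun X := of fun x y => ∑ i, X (i, x) (i, y)
  map_add' X Y := by
    ext x y
    simp only [of_apply, Matrix.add_apply, Finset.sum_add_distrib]
  map_smul' z X := by
    ext x y
    simp only [of_apply, Matrix.smul_apply, Finset.smul_sum, RingHom.id_apply]

theorem isChannel_traceLeft : IsChannel (traceLeft c a) := by
  refine ⟨fun n X hX => ?_, fun X => ?_⟩
  · exact posSemidef_traceRight
      (hX.submatrix (fun p : (Fin n × a) × c => (p.1.1, p.2, p.1.2)))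
  · simp only [traceLeft, trace, Fintype.sum_prod_type, diag_apply, LinearMap.coe_mk,
      AddHom.coe_mk, of_apply]
    exact Finset.sum_comm

end Channels

/-! ### The swap operator and non-swappability -/

section Swap

variable {b : Type*} [Fintype b] [DecidableEq b]

theorem swapOp_apply (p q : b × b) : swapOp b p q = if p = q.swap then 1 else 0 := by
  simp [swapOp, Prod.ext_iff]

theorem conjTranspose_swapOp : (swapOp b)ᴴ = swapOp b := by
  ext p q
  simp only [conjTranspose_apply, swapOp_apply, apply_ite star, star_one, star_zero]
  congr 1
  exact propext ⟨fun h => by rw [h, Prod.swap_swap], fun h => by rw [h, Prod.swap_swap]⟩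

theorem swapOp_mul (M : Matrix (b × b) (b × b) ℂ) :
    swapOp b * M = M.submatrix Prod.swap id := by
  ext p q
  have h : ∀ x : b × b, (p = x.swap) = (p.swap = x) := fun x =>
    propext ⟨fun h => by rw [h, Prod.swap_swap], fun h => by rw [← h, Prod.swap_swap]⟩
  simp [mul_apply, swapOp_apply, h]

theorem mul_swapOp (M : Matrix (b × b) (b × b) ℂ) :
    M * swapOp b = M.submatrix id Prod.swap := by
  ext p q
  simp [mul_apply, swapOp_apply]

theorem swapOp_mem_unitaryGroup : swapOp b ∈ unitaryGroup (b × b) ℂ := by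
  rw [mem_unitaryGroup_iff, star_eq_conjTranspose, conjTranspose_swapOp, swapOp_mul]
  ext p q
  have h : (p.swap = q.swap) = (p = q) := propext Prod.swap_inj
  simp [swapOp_apply, one_apply, h]

theorem swapOp_mul_kronecker (u v : Matrix b b ℂ) :
    swapOp b * (u ⊗ₖ v) = (v ⊗ₖ u) * swapOp b := by
  rw [swapOp_mul, mul_swapOp]
  ext p q
  simp [mul_comm]

theorem kronecker_mem_unitaryGroup (u v : unitaryGroup b ℂ) :
    (u : Matrix b b ℂ) ⊗ₖ (v : Matrix b b ℂ) ∈ unitaryGroup (b × b) ℂ :=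
  kronecker_mem_unitary u.2 v.2

theorem isChannel_Ad_comp_Ad_swapOp (u : unitaryGroup b ℂ × unitaryGroup b ℂ) :
    IsChannel (Ad ((u.1 : Matrix b b ℂ) ⊗ₖ (u.2 : Matrix b b ℂ)) ∘ₗ Ad (swapOp b)) :=
  (isChannel_Ad (kronecker_mem_unitaryGroup _ _)).comp (isChannel_Ad swapOp_mem_unitaryGroup)

theorem conjTranspose_mem_unitaryGroup {a : Type*} [Fintype a] [DecidableEq a]
    {W : Matrix a a ℂ} (hW : W ∈ unitaryGroup a ℂ) : Wᴴ ∈ unitaryGroup a ℂ :=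
  Unitary.star_mem hW

theorem Ad_conjTranspose_sub {a : Type*} [Fintype a] [DecidableEq a] {W Y : Matrix a a ℂ}
    (hW : W ∈ unitaryGroup a ℂ) (hY : Y ∈ unitaryGroup a ℂ) :
    Ad Wᴴ - Ad Yᴴ = Ad Wᴴ ∘ₗ (Ad Y - Ad W) ∘ₗ Ad Yᴴ := by
  have h1 : Wᴴ * W = 1 := mem_unitaryGroup_iff'.mp hW
  have h2 : Y * Yᴴ = 1 := mem_unitaryGroup_iff.mp hY
  rw [LinearMap.sub_comp, LinearMap.comp_sub, ← Ad_mul Y, h2, ← Ad_mul Wᴴ 1, ← Ad_mul W, ← Ad_mul Wᴴ,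
    ← Matrix.mul_assoc, h1, Matrix.mul_one, Matrix.one_mul]

/-- Ad_{W†} − Ad_{Y†} is Ad_Y − Ad_W between unitary channels, and the adjoint of Y = (u ⊗ v)F is
(v† ⊗ u†)F, again a swap with local unitaries. -/
theorem nonSwappability_Ad_conjTranspose_le {W : Matrix (b × b) (b × b) ℂ}
    (hW : W ∈ unitaryGroup (b × b) ℂ) :
    nonSwappability (Ad Wᴴ) ≤ nonSwappability (Ad W) := by
  refine mul_le_mul_of_nonneg_left (le_ciInf fun u => ?_) (by norm_num)
  have hb : BddBelow (Set.range fun u : unitaryGroup b ℂ × unitaryGroup b ℂ =>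
      diamondNorm (Ad Wᴴ - Ad ((u.1 : Matrix b b ℂ) ⊗ₖ (u.2 : Matrix b b ℂ)) ∘ₗ
        Ad (swapOp b))) := by
    refine ⟨0, ?_⟩
    rintro _ ⟨u, rfl⟩
    exact diamondNorm_nonneg _
  refine (ciInf_le hb (star u.2, star u.1)).trans ?_
  rw [← Ad_mul, ← Ad_mul]
  set Y := ((u.1 : Matrix b b ℂ) ⊗ₖ (u.2 : Matrix b b ℂ)) * swapOp b with hY
  have hYu : Y ∈ unitaryGroup (b × b) ℂ :=
    mul_mem (kronecker_mem_unitaryGroup _ _) swapOp_mem_unitaryGroup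
  have e : (((star u.2 : unitaryGroup b ℂ) : Matrix b b ℂ) ⊗ₖ
      ((star u.1 : unitaryGroup b ℂ) : Matrix b b ℂ)) * swapOp b = Yᴴ := by
    rw [hY, conjTranspose_mul, conjTranspose_swapOp, conjTranspose_kronecker,
      swapOp_mul_kronecker]
    rfl
  simp only [e]
  rw [Ad_conjTranspose_sub hW hYu, diamondNorm_sub_comm (Ad W)]
  exact diamondNorm_comp_sub_comp_le (isChannel_Ad (conjTranspose_mem_unitaryGroup hW))
    (isChannel_Ad hYu) (isChannel_Ad hW) (isChannel_Ad (conjTranspose_mem_unitaryGroup hYu))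

end Swap

/-! ### Probing a channel with half of a pure bipartite state -/

section Insert

variable {a b c r s : Type*}

/-- Relabelling of the basis of a system. -/
def relabel (e : b ≃ a) : OpMap a b where
  toFun X := X.submatrix e e
  map_add' _ _ := rfl
  map_smul' _ _ := rfl

/-- The insertion `X ↦ X ⊗ S` of an operator `S` on `c × b`, with the factors reordered. -/
def insertOp (r : Type*) (S : Matrix (c × b) (c × b) ℂ) : OpMap r (c × (r × b)) where
  toFun X := of fun p q => X p.2.1 q.2.1 * S (p.1, p.2.2) (q.1, q.2.2)
  map_add' X Y := by
    ext p q
    simp only [of_apply, Matrix.add_apply, add_mul]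
  map_smul' z X := by
    ext p q
    simp only [of_apply, Matrix.smul_apply, smul_eq_mul, mul_assoc, RingHom.id_apply]

variable [Fintype a] [Fintype b] [Fintype c] [Fintype r] [Fintype s]

theorem isChannel_relabel (e : b ≃ a) : IsChannel (relabel e) := by
  refine ⟨fun n X hX => ?_, fun X => ?_⟩
  · exact hX.submatrix (Prod.map id e)
  · exact e.sum_comp fun i => X i i

theorem isChannel_insertOp {S : Matrix (c × b) (c × b) ℂ} (hS : IsState S) :
    IsChannel (insertOp r S) := by
  refine ⟨fun n X hX => ?_, fun X => ?_⟩
  · exact (hX.kronecker hS.1).submatrix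
      (fun p : Fin n × (c × (r × b)) => ((p.1, p.2.2.1), (p.2.1, p.2.2.2)))
  · rw [← mul_one X.trace, ← hS.2]
    simp only [trace, diag_apply, insertOp, LinearMap.coe_mk, AddHom.coe_mk, of_apply,
      Fintype.sum_prod_type, Finset.mul_sum, Finset.sum_mul]
    refine Finset.sum_congr rfl fun i _ => ?_
    rw [Finset.sum_comm]

/-- The rank one operator with the coefficients of `s` as its vector. -/
def vecProj (t : Matrix c b ℂ) : Matrix (c × b) (c × b) ℂ :=
  vecMulVec (fun p => t p.1 p.2) (star fun p => t p.1 p.2)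

theorem isState_vecProj {t : Matrix b b ℂ} (ht : t.IsHermitian) (htr : (t * t).trace = 1) :
    IsState (vecProj t) := by
  refine ⟨posSemidef_vecMulVec_self_star _, ?_⟩
  rw [← htr]
  simp only [trace, vecProj, diag_apply, vecMulVec_apply, Fintype.sum_prod_type, mul_apply,
    Pi.star_apply, ht.apply]

/-- `Y ↦ (N ⊗ id)(Y ⊗ S)`, with the output of `N` on the second factor placed next to the
reference. -/
def probe [DecidableEq b] (t : Matrix b b ℂ) (N : OpMap (r × b) (s × b)) :
    OpMap r (s × (b × b)) :=
  relabel ((Equiv.prodAssoc s b b).symm.trans (Equiv.prodComm (s × b) b)) ∘ₗ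
    ampliate b N ∘ₗ insertOp r (vecProj t)

variable [DecidableEq b]

theorem isChannel_probe {t : Matrix b b ℂ} (ht : t.IsHermitian) (htr : (t * t).trace = 1)
    {N : OpMap (r × b) (s × b)} (hN : IsChannel N) : IsChannel (probe t N) :=
  (isChannel_relabel _).comp (hN.ampliate.comp (isChannel_insertOp (isState_vecProj ht htr)))

theorem probe_apply (t : Matrix b b ℂ) (N : OpMap (r × b) (s × b)) (Y : Matrix r r ℂ)
    (k l : s) (x y i j : b) :
    probe t N Y (k, x, i) (l, y, j)
      = N (Y ⊗ₖ vecMulVec (t i) (star (t j))) (k, x) (l, y) := rfl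

end Insert

/-! ### Generalized transposition as conjugation of Choi matrices -/

section Transpose

variable {a b c d r s : Type*} [Fintype a] [Fintype b] [Fintype r] [Fintype s]
  [DecidableEq a] [DecidableEq b] [DecidableEq r]

theorem linearMap_apply_eq_sum {M : Type*} [AddCommMonoid M] [Module ℂ M]
    (L : Matrix r r ℂ →ₗ[ℂ] M) (X : Matrix r r ℂ) :
    L X = ∑ i, ∑ j, X i j • L (single i j 1) := by
  conv_lhs => rw [matrix_eq_sum_single X]
  simp only [map_sum]
  refine Finset.sum_congr rfl fun i _ => Finset.sum_congr rfl fun j _ => ?_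
  rw [← map_smul, smul_single, smul_eq_mul, mul_one]

/-- The Choi matrix of the component `X ↦ ⟨k| N(Y ⊗ X) |l⟩`. -/
def blockChoi (N : OpMap (r × b) (s × b)) (k l : s) :
    Matrix r r ℂ →ₗ[ℂ] Matrix (b × b) (b × b) ℂ where
  toFun Y := of fun p q => N (Y ⊗ₖ single p.2 q.2 1) (k, p.1) (l, q.1)
  map_add' X Y := by
    ext p q
    simp only [add_kronecker, map_add, of_apply, Matrix.add_apply]
  map_smul' z X := by
    ext p q
    simp only [smul_kronecker, map_smul, of_apply, Matrix.smul_apply, RingHom.id_apply]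

/-- The pure state with coefficients t is 1 ⊗ t applied to the unnormalized maximally entangled
vector; the factor on the reference commutes with N and ends up around the Choi matrix. -/
theorem probe_block {t : Matrix b b ℂ} (ht : t.IsHermitian) (N : OpMap (r × b) (s × b))
    (Y : Matrix r r ℂ) (k l : s) :
    (probe t N Y).submatrix (Prod.mk k) (Prod.mk l)
      = ((1 : Matrix b b ℂ) ⊗ₖ t) * blockChoi N k l Y * ((1 : Matrix b b ℂ) ⊗ₖ t) := by
  ext ⟨x, i⟩ ⟨y, j⟩
  rw [submatrix_apply, probe_apply]
  let L : Matrix b b ℂ →ₗ[ℂ] ℂ :=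
    { toFun := fun X => N (Y ⊗ₖ X) (k, x) (l, y)
      map_add' := fun X X' => by rw [kronecker_add, map_add, Matrix.add_apply]
      map_smul' := fun z X => by
        rw [kronecker_smul, map_smul, Matrix.smul_apply, RingHom.id_apply] }
  have h := linearMap_apply_eq_sum L (vecMulVec (t i) (star (t j)))
  refine h.trans ?_
  simp only [mul_apply, Fintype.sum_prod_type, kroneckerMap_apply, one_apply, ite_mul, one_mul,
    zero_mul, mul_ite, mul_zero, Finset.sum_ite_eq, Finset.sum_ite_eq', Finset.mem_univ,
    if_true, Finset.sum_ite_irrel, Finset.sum_const_zero, vecMulVec_apply, Pi.star_apply,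
    ht.apply, smul_eq_mul, Finset.sum_mul]
  rw [Finset.sum_comm]
  refine Finset.sum_congr rfl fun e _ => Finset.sum_congr rfl fun f _ => ?_
  show t i f * t e j * N (Y ⊗ₖ single f e 1) (k, x) (l, y)
    = t i f * N (Y ⊗ₖ single f e 1) (k, x) (l, y) * t e j
  ring

theorem traceRight_mul_kronecker (M : Matrix (b × b) (b × b) ℂ) (t : Matrix b b ℂ) :
    traceRight b b (((1 : Matrix b b ℂ) ⊗ₖ t) * M * ((1 : Matrix b b ℂ) ⊗ₖ t))
      = ofChoi M (t * t)ᵀ := by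
  ext x y
  simp only [traceRight, ofChoi, LinearMap.coe_mk, AddHom.coe_mk, of_apply, mul_apply,
    Fintype.sum_prod_type, kroneckerMap_apply, one_apply, ite_mul, one_mul,
    zero_mul, mul_ite, mul_zero, Finset.sum_ite_eq, Finset.sum_ite_eq', Finset.mem_univ,
    if_true, Finset.sum_ite_irrel, Finset.sum_const_zero, Finset.sum_mul, transpose_apply,
    Finset.mul_sum]
  rw [Finset.sum_comm]
  refine (Finset.sum_congr rfl fun j _ => Finset.sum_comm).trans (Finset.sum_comm.trans ?_)
  refine Finset.sum_congr rfl fun i _ => Finset.sum_congr rfl fun j _ =>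
    Finset.sum_congr rfl fun c _ => ?_
  ring

/-- If `W` intertwines `1 ⊗ t` and `1 ⊗ s`, the preparation of `(t²)ᵀ` composed with the
transposition `T[W†]` is realized by probing with `s` and applying `W†`. -/
theorem applyPart_prep_genTranspose {W : Matrix (b × b) (b × b) ℂ} {t u : Matrix b b ℂ}
    (hu : u.IsHermitian)
    (h1 : W * ((1 : Matrix b b ℂ) ⊗ₖ t) = ((1 : Matrix b b ℂ) ⊗ₖ u) * W)
    (h2 : ((1 : Matrix b b ℂ) ⊗ₖ t) * Wᴴ = Wᴴ * ((1 : Matrix b b ℂ) ⊗ₖ u))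
    (N : OpMap (r × b) (s × b)) :
    applyPart (prep (t * t)ᵀ ∘ₗ genTranspose Wᴴ) N
      = ampliate s (traceRight b b ∘ₗ Ad Wᴴ) ∘ₗ probe u N ∘ₗ
          relabel (Equiv.prodUnique r Unit).symm := by
  ext1 Y
  ext ⟨k, x⟩ ⟨l, y⟩
  have hL : applyPart (prep (t * t)ᵀ ∘ₗ genTranspose Wᴴ) N Y (k, x) (l, y)
      = ofChoi (Ad Wᴴ (blockChoi N k l (relabel (Equiv.prodUnique r Unit).symm Y)))
          (t * t)ᵀ x y := by
    rw [linearMap_apply_eq_sum (blockChoi N k l)]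
    simp only [map_sum, map_smul, LinearMap.sum_apply, LinearMap.smul_apply, Matrix.sum_apply,
      Matrix.smul_apply]
    rfl
  have hR : (ampliate s (traceRight b b ∘ₗ Ad Wᴴ) ∘ₗ probe u N ∘ₗ
        relabel (Equiv.prodUnique r Unit).symm) Y (k, x) (l, y)
      = traceRight b b (Ad Wᴴ ((probe u N (relabel (Equiv.prodUnique r Unit).symm Y)).submatrix
          (Prod.mk k) (Prod.mk l))) x y := rfl
  -- Both sides are now partial traces of sandwiched Choi blocks; the intertwining relations carry 1
  -- ⊗ t through W† and W, turning it into 1 ⊗ u.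
  rw [hL, hR, probe_block hu, ← traceRight_mul_kronecker]
  simp only [Ad_apply, conjTranspose_conjTranspose]
  rw [← Matrix.mul_assoc, ← Matrix.mul_assoc, h2]
  simp only [Matrix.mul_assoc]
  rw [h1]

theorem choi_ofChoi (J : Matrix (b × b) (b × b) ℂ) : choi (ofChoi J) = J := by
  ext ⟨x, i⟩ ⟨y, j⟩
  simp [choi, ofChoi, single_apply, ite_and]

theorem ofChoi_choi (N : OpMap b b) : ofChoi (choi N) = N := by
  ext1 X
  rw [linearMap_apply_eq_sum N X]
  ext x y
  simp [choi, ofChoi, Matrix.sum_apply, mul_comm]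

theorem genTranspose_genTranspose {W : Matrix (b × b) (b × b) ℂ}
    (hW : W ∈ unitaryGroup (b × b) ℂ) (N : OpMap b b) :
    genTranspose Wᴴ (genTranspose W N) = N := by
  have h : Wᴴ * W = 1 := mem_unitaryGroup_iff'.mp hW
  simp only [genTranspose, LinearMap.comp_apply, choi_ofChoi]
  rw [← LinearMap.comp_apply (Ad Wᴴ), ← Ad_mul, h, Ad_apply, conjTranspose_one, Matrix.mul_one,
    Matrix.one_mul, ofChoi_choi]

theorem component_applyPart (Θ : OpMap a b →ₗ[ℂ] OpMap c d) (N : OpMap (r × a) (s × b))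
    (i j : r) (k l : s) :
    component (applyPart Θ N) i j k l = Θ (component N i j k l) := by
  ext1 X
  ext x y
  have h : ∀ i' j', ((single i j (1 : ℂ)) ⊗ₖ X).submatrix (Prod.mk i') (Prod.mk j')
      = single i j (1 : ℂ) i' j' • X := fun i' j' => by
    ext x y
    simp
  simp only [component, applyPart, LinearMap.coe_mk, AddHom.coe_mk, of_apply]
  change ∑ i', ∑ j', Θ (component N i' j' k l) _ x y = Θ (component N i j k l) X x y
  simp only [h, map_smul, Matrix.smul_apply, single_apply, ite_and]
  simp

/-- Each component of U is T[W†] of the corresponding component of its transpose, so preparing σ at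
the input of U is the preparation supermap after T[W†]. -/
theorem reducedMap_eq {W : Matrix (b × b) (b × b) ℂ} (hW : W ∈ unitaryGroup (b × b) ℂ)
    (U : OpMap (a × b) (a × b)) (σ : Matrix b b ℂ) :
    reducedMap U σ = traceLeft a b ∘ₗ
      applyPart (prep σ ∘ₗ genTranspose Wᴴ) (applyPart (genTranspose W) U) ∘ₗ
        relabel (Equiv.prodUnique a Unit) := by
  ext1 ρ
  ext x y
  simp only [reducedMap, traceLeft, LinearMap.comp_apply, LinearMap.coe_mk, AddHom.coe_mk,
    of_apply]
  refine Finset.sum_congr rfl fun k _ => ?_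
  let L : Matrix a a ℂ →ₗ[ℂ] ℂ :=
    { toFun := fun X => U (X ⊗ₖ σ) (k, x) (k, y)
      map_add' := fun X X' => by rw [add_kronecker, map_add, Matrix.add_apply]
      map_smul' := fun z X => by
        rw [smul_kronecker, map_smul, Matrix.smul_apply, RingHom.id_apply] }
  refine (linearMap_apply_eq_sum L ρ).trans ?_
  simp only [applyPart, LinearMap.coe_mk, AddHom.coe_mk, of_apply, LinearMap.comp_apply]
  refine Finset.sum_congr rfl fun i _ => Finset.sum_congr rfl fun j _ => ?_
  have := component_applyPart (genTranspose W) U i j k k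
  simp only [applyPart] at this
  rw [this, genTranspose_genTranspose hW]
  rfl

end Transpose

/-! ### Intertwining of square roots -/

section Sqrt

variable {a b : Type*} [Fintype a] [DecidableEq a] [Fintype b] [DecidableEq b]

open scoped MatrixOrder in
theorem exists_posSemidef_sqrt {A : Matrix a a ℂ} (hA : A.PosSemidef) :
    ∃ B : Matrix a a ℂ, B.PosSemidef ∧ B * B = A :=
  ⟨CFC.sqrt A, (CFC.sqrt_nonneg A).posSemidef, CFC.sqrt_mul_sqrt_self A hA.nonneg⟩

open scoped MatrixOrder in
theorem eq_of_posSemidef_of_mul_self_eq {A B : Matrix a a ℂ} (hA : A.PosSemidef)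
    (hB : B.PosSemidef) (h : A * A = B * B) : A = B := by
  rw [← CFC.sqrt_unique h hA.nonneg, CFC.sqrt_unique rfl hB.nonneg]

/-- If `W` maps `1 ⊗ σᵀ` to `1 ⊗ ω`, it intertwines the square roots. -/
theorem exists_intertwined_sqrt [Nonempty b] {W : Matrix (b × b) (b × b) ℂ}
    (hW : W ∈ unitaryGroup (b × b) ℂ) {σ ω : Matrix b b ℂ} (hσ : IsState σ)
    (h : W * ((1 : Matrix b b ℂ) ⊗ₖ σᵀ) * Wᴴ = (1 : Matrix b b ℂ) ⊗ₖ ω) :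
    ∃ t u : Matrix b b ℂ, σ = (t * t)ᵀ ∧ u.IsHermitian ∧ IsState (u * u) ∧
      W * ((1 : Matrix b b ℂ) ⊗ₖ t) = ((1 : Matrix b b ℂ) ⊗ₖ u) * W ∧
      ((1 : Matrix b b ℂ) ⊗ₖ t) * Wᴴ = Wᴴ * ((1 : Matrix b b ℂ) ⊗ₖ u) := by
  have hWW : Wᴴ * W = 1 := mem_unitaryGroup_iff'.mp hW
  obtain ⟨x⟩ := ‹Nonempty b›
  have hG := (PosSemidef.one (n := b) (R := ℂ)).kronecker hσ.1.transpose
  -- ω is a diagonal block of 1 ⊗ ω.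
  have hω : ω.PosSemidef := by
    have := (hG.mul_mul_conjTranspose_same W).submatrix (Prod.mk x)
    rw [h] at this
    have e : ω = ((1 : Matrix b b ℂ) ⊗ₖ ω).submatrix (Prod.mk x) (Prod.mk x) := by
      ext i j
      simp
    rw [e]
    exact this
  have htr : ω.trace = 1 := by
    have h1 : (W * ((1 : Matrix b b ℂ) ⊗ₖ σᵀ) * Wᴴ).trace = Fintype.card b := by
      rw [trace_mul_comm, ← Matrix.mul_assoc, hWW, Matrix.one_mul, trace_kronecker, trace_one,
        trace_transpose, hσ.2, mul_one]
    rw [h, trace_kronecker, trace_one] at h1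
    have hd : (Fintype.card b : ℂ) ≠ 0 := by
      have : Fintype.card b ≠ 0 := (Fintype.card_pos_iff.mpr ⟨x⟩).ne'
      exact_mod_cast this
    exact mul_left_cancel₀ hd (h1.trans (mul_one _).symm)
  obtain ⟨t, ht, htt⟩ := exists_posSemidef_sqrt hσ.1.transpose
  obtain ⟨u, hu, huu⟩ := exists_posSemidef_sqrt hω
  have hkey : W * ((1 : Matrix b b ℂ) ⊗ₖ t) * Wᴴ = (1 : Matrix b b ℂ) ⊗ₖ u := by
    refine eq_of_posSemidef_of_mul_self_eq
      ((PosSemidef.one.kronecker ht).mul_mul_conjTranspose_same W) (PosSemidef.one.kronecker hu) ?_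
    rw [← mul_kronecker_mul, huu, Matrix.one_mul, ← h, ← htt]
    calc _ = W * ((1 : Matrix b b ℂ) ⊗ₖ t) * (Wᴴ * W) * ((1 : Matrix b b ℂ) ⊗ₖ t) * Wᴴ := by
          simp only [Matrix.mul_assoc]
      _ = W * (((1 : Matrix b b ℂ) ⊗ₖ t) * ((1 : Matrix b b ℂ) ⊗ₖ t)) * Wᴴ := by
          rw [hWW, Matrix.mul_one, Matrix.mul_assoc W]
      _ = _ := by rw [← mul_kronecker_mul, Matrix.one_mul]
  refine ⟨t, u, ?_, hu.1, ?_, ?_, ?_⟩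
  · rw [htt, transpose_transpose]
  · rw [huu]
    exact ⟨hω, htr⟩
  · rw [← hkey, Matrix.mul_assoc _ Wᴴ, hWW, Matrix.mul_one]
  · rw [← hkey, ← Matrix.mul_assoc, ← Matrix.mul_assoc, hWW, Matrix.one_mul]

end Sqrt

/-! ### What compatibility of a state means for W -/

section Compatibility

variable {b : Type*} [Fintype b] [DecidableEq b]

theorem isChannel_ofChoi {J : Matrix (b × b) (b × b) ℂ} (hJ : J.PosSemidef)
    (htr : traceLeft b b J = 1) : IsChannel (ofChoi J) := by
  refine ⟨fun n X hX => ?_, fun X => ?_⟩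
  · have h := posSemidef_sum_blocks ((hJ.kronecker hX).submatrix
      (fun p : (Fin n × b) × b => ((p.1.2, p.2), (p.1.1, p.2))))
    have e : ampliate (Fin n) (ofChoi J) X = of fun p q => ∑ i, ∑ j,
        (J ⊗ₖ X).submatrix (fun p : (Fin n × b) × b => ((p.1.2, p.2), (p.1.1, p.2)))
          (fun p : (Fin n × b) × b => ((p.1.2, p.2), (p.1.1, p.2))) (p, i) (q, j) := by
      ext p q
      simp only [ampliate_apply, ofChoi, LinearMap.coe_mk, AddHom.coe_mk, of_apply,
        submatrix_apply, kroneckerMap_apply]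
    rw [e]
    exact h
  · have h : ∀ i j, ∑ x, J (x, i) (x, j) = (1 : Matrix b b ℂ) i j := fun i j =>
      congrFun (congrFun htr i) j
    simp only [trace, diag_apply, ofChoi, LinearMap.coe_mk, AddHom.coe_mk, of_apply]
    rw [Finset.sum_comm]
    refine Finset.sum_congr rfl fun i _ => ?_
    rw [Finset.sum_comm]
    simp only [← Finset.sum_mul, h, one_apply, ite_mul, one_mul, zero_mul, Finset.sum_ite_eq,
      Finset.mem_univ, if_true]

theorem trace_ofChoi (M : Matrix (b × b) (b × b) ℂ) (σ : Matrix b b ℂ) :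
    (ofChoi M σ).trace = (M * ((1 : Matrix b b ℂ) ⊗ₖ σᵀ)).trace := by
  simp only [trace, diag_apply, ofChoi, LinearMap.coe_mk, AddHom.coe_mk, of_apply, mul_apply,
    Fintype.sum_prod_type, kroneckerMap_apply, one_apply, ite_mul, one_mul, zero_mul, mul_ite,
    mul_zero, Finset.sum_ite_irrel, Finset.sum_const_zero, transpose_apply, Finset.sum_ite_eq',
    Finset.mem_univ, if_true]

theorem trace_mul_one_kronecker (M : Matrix (b × b) (b × b) ℂ) (ω : Matrix b b ℂ) :
    (M * ((1 : Matrix b b ℂ) ⊗ₖ ω)).trace = (traceLeft b b M * ω).trace := by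
  simp only [trace, diag_apply, traceLeft, LinearMap.coe_mk, AddHom.coe_mk, of_apply, mul_apply,
    Fintype.sum_prod_type, kroneckerMap_apply, one_apply, ite_mul, one_mul, zero_mul, mul_ite,
    mul_zero, Finset.sum_ite_irrel, Finset.sum_const_zero, Finset.sum_ite_eq',
    Finset.mem_univ, if_true, Finset.sum_mul]
  rw [Finset.sum_comm]
  exact Finset.sum_congr rfl fun i _ => Finset.sum_comm

theorem traceLeft_one_kronecker (ω : Matrix b b ℂ) :
    traceLeft b b ((1 : Matrix b b ℂ) ⊗ₖ ω) = (Fintype.card b : ℂ) • ω := by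
  ext i j
  simp [traceLeft]

theorem exists_posSemidef_add_smul_one {a : Type*} [Fintype a] [DecidableEq a]
    {K : Matrix a a ℂ} (hK : K.IsHermitian) :
    ∃ c : ℝ, 0 < c ∧ ((c : ℂ) • (1 : Matrix a a ℂ) + K).PosSemidef := by
  set V : Matrix a a ℂ := (hK.eigenvectorUnitary : Matrix a a ℂ) with hV
  have hVV : V * Vᴴ = 1 := Unitary.coe_mul_star_self hK.eigenvectorUnitary
  have hsp : K = V * diagonal (fun i => (hK.eigenvalues i : ℂ)) * Vᴴ := by
    have := hK.spectral_theorem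
    rw [Unitary.conjStarAlgAut_apply] at this
    exact this
  refine ⟨1 + ∑ i, |hK.eigenvalues i|, by positivity, ?_⟩
  set c : ℝ := 1 + ∑ i, |hK.eigenvalues i| with hc
  have e : (c : ℂ) • (1 : Matrix a a ℂ) + K
      = V * diagonal (fun i => ((c + hK.eigenvalues i : ℝ) : ℂ)) * Vᴴ := by
    have : diagonal (fun i => ((c + hK.eigenvalues i : ℝ) : ℂ))
        = (c : ℂ) • (1 : Matrix a a ℂ) + diagonal (fun i => (hK.eigenvalues i : ℂ)) := by
      rw [smul_one_eq_diagonal, diagonal_add]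
      simp
    rw [this, Matrix.mul_add, Matrix.add_mul, ← hsp, Matrix.mul_smul, Matrix.mul_one,
      Matrix.smul_mul, hVV]
  rw [e]
  refine (PosSemidef.diagonal fun i => ?_).mul_mul_conjTranspose_same V
  have h1 : |hK.eigenvalues i| ≤ ∑ i, |hK.eigenvalues i| :=
    Finset.single_le_sum (f := fun i => |hK.eigenvalues i|) (fun _ _ => abs_nonneg _)
      (Finset.mem_univ i)
  have h2 := neg_abs_le (hK.eigenvalues i)
  have h3 : 0 ≤ c + hK.eigenvalues i := by rw [hc]; linarith
  show (0 : ℂ) ≤ _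
  exact_mod_cast h3

/-- An observable with expectation `1` in every Choi matrix of a channel is of the form
`1 ⊗ ω`. -/
theorem eq_one_kronecker_of_trace_eq_one [Nonempty b] {G : Matrix (b × b) (b × b) ℂ}
    (hG : G.IsHermitian)
    (h : ∀ J : Matrix (b × b) (b × b) ℂ, J.PosSemidef → traceLeft b b J = 1 →
      (J * G).trace = 1) :
    ∃ ω : Matrix b b ℂ, G = (1 : Matrix b b ℂ) ⊗ₖ ω := by
  have hd0 : (0 : ℝ) < Fintype.card b := by exact_mod_cast Fintype.card_pos
  have hd : (Fintype.card b : ℂ) ≠ 0 := by exact_mod_cast hd0.ne'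
  set d : ℂ := (Fintype.card b : ℂ) with hdd
  -- The only possible choice, obtained by tracing out the first factor of G = 1 ⊗ ω.
  set ω : Matrix b b ℂ := d⁻¹ • traceLeft b b G with hω
  have hωH : ω.IsHermitian := by
    ext i j
    have : ∀ k, star (G (k, j) (k, i)) = G (k, i) (k, j) := fun k => hG.apply _ _
    simp only [hω, conjTranspose_apply, Matrix.smul_apply, smul_eq_mul, star_mul', traceLeft,
      LinearMap.coe_mk, AddHom.coe_mk, of_apply, star_sum, this]
    simp [hdd]
  refine ⟨ω, ?_⟩
  set K := G - (1 : Matrix b b ℂ) ⊗ₖ ω with hK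
  have hKH : K.IsHermitian := by
    refine hG.sub ?_
    rw [IsHermitian, conjTranspose_kronecker, conjTranspose_one, hωH.eq]
  have hKt : traceLeft b b K = 0 := by
    rw [hK, map_sub, traceLeft_one_kronecker, hω, smul_smul, mul_inv_cancel₀ hd, one_smul,
      sub_self]
  have hone : traceLeft b b (1 : Matrix (b × b) (b × b) ℂ) = d • (1 : Matrix b b ℂ) := by
    rw [← one_kronecker_one, traceLeft_one_kronecker]
  obtain ⟨c, hc, hcK⟩ := exists_posSemidef_add_smul_one hKH
  have hcc : (c : ℂ) ≠ 0 := by exact_mod_cast hc.ne'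
  have hdn : 0 ≤ d⁻¹ := by
    rw [hdd, ← Complex.ofReal_natCast, ← Complex.ofReal_inv]
    exact_mod_cast inv_nonneg.mpr hd0.le
  have hcn : 0 ≤ ((c : ℂ))⁻¹ := by
    rw [← Complex.ofReal_inv]
    exact_mod_cast inv_nonneg.mpr hc.le
  have h1 := h (d⁻¹ • (1 : Matrix (b × b) (b × b) ℂ)) (PosSemidef.one.smul hdn) (by
    rw [map_smul, hone, smul_smul, inv_mul_cancel₀ hd, one_smul])
  -- Perturb the Choi matrix 1/d of the depolarizing channel in the direction K = G − 1 ⊗ ω: the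
  -- marginal is unchanged because K has zero partial trace, and c keeps it positive. Comparing with
  -- `h1` gives Tr KG = 0, hence Tr K² = 0.
  have h2 := h (d⁻¹ • (c : ℂ)⁻¹ • ((c : ℂ) • (1 : Matrix (b × b) (b × b) ℂ) + K))
    ((hcK.smul hcn).smul hdn) (by
      rw [map_smul, map_smul, map_add, map_smul, hKt, hone, add_zero, smul_smul, smul_smul,
        smul_smul, mul_assoc, ← mul_assoc, mul_assoc d⁻¹, inv_mul_cancel₀ hcc, mul_one,
        inv_mul_cancel₀ hd, one_smul])
  have h3 : (K * G).trace = 0 := by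
    rw [smul_add, smul_smul, inv_mul_cancel₀ hcc, one_smul, smul_add, Matrix.add_mul, trace_add,
      h1, add_eq_left, smul_smul, Matrix.smul_mul, trace_smul, smul_eq_mul] at h2
    exact (mul_eq_zero.mp h2).resolve_left (mul_ne_zero (inv_ne_zero hd) (inv_ne_zero hcc))
  have h4 : (Kᴴ * K).trace = 0 := by
    rw [hKH.eq]
    conv_lhs => rw [show K * K = K * G - K * ((1 : Matrix b b ℂ) ⊗ₖ ω) by
      rw [← Matrix.mul_sub]]
    rw [trace_sub, h3, trace_mul_one_kronecker, hKt, Matrix.zero_mul, trace_zero, sub_zero]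
  exact sub_eq_zero.mp (trace_conjTranspose_mul_self_eq_zero_iff.mp h4)

theorem component_ampliate (N : OpMap b b) :
    component (ampliate (Fin 1) N) 0 0 0 0 = N := by
  ext1 X
  ext x y
  have : (single (0 : Fin 1) (0 : Fin 1) (1 : ℂ) ⊗ₖ X).submatrix (Prod.mk 0) (Prod.mk 0)
      = X := by
    ext i j
    simp
  simp only [component, LinearMap.coe_mk, AddHom.coe_mk, of_apply, ampliate_apply, this]

theorem trace_applyPart_prep (Θ : OpMap b b →ₗ[ℂ] OpMap b b) (N : OpMap b b)
    (σ : Matrix b b ℂ) :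
    (applyPart (prep σ ∘ₗ Θ) (ampliate (Fin 1) N) 1).trace = (Θ N σ).trace := by
  simp [trace, Fintype.sum_prod_type, applyPart, component_ampliate, prep]

/-- Only trace preservation on channels with a trivial extra system is needed: it says that W(1 ⊗
σᵀ)W† has expectation 1 in the Choi matrix of every channel. -/
theorem PrepCompatible.exists_eq [Nonempty b] {W : Matrix (b × b) (b × b) ℂ} {σ : Matrix b b ℂ}
    (hσ : IsState σ) (h : PrepCompatible W σ) :
    ∃ ω : Matrix b b ℂ, W * ((1 : Matrix b b ℂ) ⊗ₖ σᵀ) * Wᴴ = (1 : Matrix b b ℂ) ⊗ₖ ω := by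
  have hG := ((PosSemidef.one (n := b) (R := ℂ)).kronecker
    hσ.1.transpose).mul_mul_conjTranspose_same W
  refine eq_one_kronecker_of_trace_eq_one hG.1 fun J hJ hJt => ?_
  have hN := (h 1 1 _ (isChannel_ofChoi hJ hJt).ampliate).2 1
  rw [trace_applyPart_prep, genTranspose, LinearMap.comp_apply, LinearMap.comp_apply,
    choi_ofChoi, trace_ofChoi, Ad_apply, conjTranspose_conjTranspose] at hN
  have ht : ((1 : Matrix (Fin 1 × Unit) (Fin 1 × Unit) ℂ)).trace = 1 := by simp
  rw [ht] at hN
  rw [← hN, ← Matrix.mul_assoc, trace_mul_comm]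
  simp only [Matrix.mul_assoc]

end Compatibility

/-! ### The leakage bound -/

section Leakage

variable {a b c : Type*} [Fintype a] [Fintype b] [Fintype c] [DecidableEq a] [DecidableEq b]

theorem traceLeft_comp_ampliate (Φ : OpMap c b) :
    traceLeft a b ∘ₗ ampliate a Φ = Φ ∘ₗ traceLeft a c := by
  ext1 X
  have h : traceLeft a c X = ∑ i, X.submatrix (Prod.mk i) (Prod.mk i) := by
    ext x y
    simp [traceLeft, Matrix.sum_apply]
  rw [LinearMap.comp_apply, LinearMap.comp_apply, h, map_sum]
  ext x y
  rw [Matrix.sum_apply]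
  rfl

theorem relabel_comp_relabel (e : a ≃ b) : relabel e ∘ₗ relabel e.symm = LinearMap.id := by
  ext1 X
  ext x y
  change X (e.symm (e x)) (e.symm (e y)) = X x y
  simp

theorem traceRight_kronecker_one_mul (v : Matrix b b ℂ) (M : Matrix (b × b) (b × b) ℂ) :
    traceRight b b ((v ⊗ₖ (1 : Matrix b b ℂ)) * M) = v * traceRight b b M := by
  ext x y
  simp only [traceRight, LinearMap.coe_mk, AddHom.coe_mk, of_apply, mul_apply,
    Fintype.sum_prod_type, kroneckerMap_apply, one_apply, mul_ite, mul_one, mul_zero, ite_mul,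
    zero_mul, Finset.sum_ite_eq, Finset.mem_univ, if_true, Finset.mul_sum]
  exact Finset.sum_comm

theorem traceRight_mul_kronecker_one (v : Matrix b b ℂ) (M : Matrix (b × b) (b × b) ℂ) :
    traceRight b b (M * (v ⊗ₖ (1 : Matrix b b ℂ))) = traceRight b b M * v := by
  ext x y
  simp only [traceRight, LinearMap.coe_mk, AddHom.coe_mk, of_apply, mul_apply,
    Fintype.sum_prod_type, kroneckerMap_apply, one_apply, mul_ite, mul_one, mul_zero,
    Finset.sum_ite_eq', Finset.mem_univ, if_true, Finset.sum_mul]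
  exact Finset.sum_comm

theorem traceRight_one_kronecker_mul_comm (w : Matrix b b ℂ) (M : Matrix (b × b) (b × b) ℂ) :
    traceRight b b (((1 : Matrix b b ℂ) ⊗ₖ w) * M)
      = traceRight b b (M * ((1 : Matrix b b ℂ) ⊗ₖ w)) := by
  ext x y
  simp only [traceRight, LinearMap.coe_mk, AddHom.coe_mk, of_apply, mul_apply,
    Fintype.sum_prod_type, kroneckerMap_apply, one_apply, ite_mul, one_mul, zero_mul, mul_ite,
    mul_zero, Finset.sum_ite_irrel, Finset.sum_const_zero, Finset.sum_ite_eq,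
    Finset.sum_ite_eq', Finset.mem_univ, if_true]
  rw [Finset.sum_comm]
  exact Finset.sum_congr rfl fun i _ => Finset.sum_congr rfl fun j _ => mul_comm _ _

theorem traceRight_Ad_kronecker (v : Matrix b b ℂ) {w : Matrix b b ℂ}
    (hw : w ∈ unitaryGroup b ℂ) (M : Matrix (b × b) (b × b) ℂ) :
    traceRight b b (Ad (v ⊗ₖ w) M) = v * traceRight b b M * vᴴ := by
  have hww : wᴴ * w = 1 := mem_unitaryGroup_iff'.mp hw
  have e : Ad (v ⊗ₖ w) M = (v ⊗ₖ (1 : Matrix b b ℂ)) *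
      (((1 : Matrix b b ℂ) ⊗ₖ w) * (M * ((1 : Matrix b b ℂ) ⊗ₖ wᴴ))) *
        (vᴴ ⊗ₖ (1 : Matrix b b ℂ)) := by
    have h1 : v ⊗ₖ w = (v ⊗ₖ (1 : Matrix b b ℂ)) * ((1 : Matrix b b ℂ) ⊗ₖ w) := by
      rw [← mul_kronecker_mul, Matrix.mul_one, Matrix.one_mul]
    have h2 : vᴴ ⊗ₖ wᴴ = ((1 : Matrix b b ℂ) ⊗ₖ wᴴ) * (vᴴ ⊗ₖ (1 : Matrix b b ℂ)) := by
      rw [← mul_kronecker_mul, Matrix.mul_one, Matrix.one_mul]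
    rw [Ad_apply, conjTranspose_kronecker, h1, h2]
    simp only [Matrix.mul_assoc]
  rw [e, traceRight_mul_kronecker_one, traceRight_kronecker_one_mul,
    traceRight_one_kronecker_mul_comm, Matrix.mul_assoc M, ← mul_kronecker_mul, hww,
    Matrix.one_mul, one_kronecker_one, Matrix.mul_one]

theorem traceRight_Ad_swapOp (M : Matrix (b × b) (b × b) ℂ) :
    traceRight b b (Ad (swapOp b) M) = traceLeft b b M := by
  rw [Ad_apply, conjTranspose_swapOp, swapOp_mul, mul_swapOp]
  rfl

/-- Discarding both outputs of a trace-preserving V leaves the reference in its initial reduced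
state u², whatever the input. -/
theorem traceLeft_traceLeft_probe {u : Matrix b b ℂ} (hu : u.IsHermitian)
    {V : OpMap (a × b) (a × b)} (hV : IsTP V) (ρ : Matrix a a ℂ) :
    traceLeft b b (traceLeft a (b × b) (probe u V ρ)) = ρ.trace • (u * u) := by
  ext i j
  have h := hV (ρ ⊗ₖ vecMulVec (u i) (star (u j)))
  rw [trace_kronecker] at h
  have h2 : (vecMulVec (u i) (star (u j))).trace = (u * u) i j := by
    simp [trace, vecMulVec_apply, mul_apply, ← hu.apply _ j]
  rw [Matrix.smul_apply, smul_eq_mul, ← h2, ← h]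
  simp only [traceLeft, LinearMap.coe_mk, AddHom.coe_mk, of_apply, probe_apply, trace, diag_apply,
    Fintype.sum_prod_type]
  exact Finset.sum_comm

theorem IsState.Ad {τ v : Matrix b b ℂ} (hτ : IsState τ) (hv : v ∈ unitaryGroup b ℂ) :
    IsState (v * τ * vᴴ) :=
  ⟨hτ.1.mul_mul_conjTranspose_same v, ((isChannel_Ad hv).2 τ).trans hτ.2⟩

theorem geomCapacity_le (N : OpMap a b) {τ : Matrix b b ℂ} (hτ : IsState τ) :
    geomCapacity N ≤ (1 / 2) * diamondNorm (N - initMap a τ) := by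
  refine mul_le_mul_of_nonneg_left ?_ (by norm_num)
  refine ciInf_le (f := fun τ : {τ : Matrix b b ℂ // IsState τ} =>
    diamondNorm (N - initMap a τ.1)) ⟨0, ?_⟩ ⟨τ, hτ⟩
  rintro _ ⟨τ, rfl⟩
  exact diamondNorm_nonneg _

theorem leakage_le_nonSwappability [Nonempty b] {U : OpMap (a × b) (a × b)}
    {W : Matrix (b × b) (b × b) ℂ} (hW : W ∈ unitaryGroup (b × b) ℂ) (hU : IsCompatible W U)
    {σ : Matrix b b ℂ} (hσ : IsState σ) (hWσ : PrepCompatible W σ) :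
    leakage U σ ≤ nonSwappability (Ad Wᴴ) := by
  obtain ⟨ω, hω⟩ := hWσ.exists_eq hσ
  obtain ⟨t, u, rfl, hu, huu, h1, h2⟩ := exists_intertwined_sqrt hW hσ hω
  set V := applyPart (genTranspose W) U with hV
  have hVc : IsChannel V := hU
  set Λ : OpMap a (b × b) := traceLeft a (b × b) ∘ₗ probe u V with hΛ
  have hΛc : IsChannel Λ := isChannel_traceLeft.comp (isChannel_probe hu huu.2 hVc)
  have hR : reducedMap U (t * t)ᵀ = traceRight b b ∘ₗ Ad Wᴴ ∘ₗ Λ := by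
    rw [reducedMap_eq hW, applyPart_prep_genTranspose hu h1 h2, ← hV]
    calc _ = (traceLeft a b ∘ₗ ampliate a (traceRight b b ∘ₗ Ad Wᴴ)) ∘ₗ probe u V ∘ₗ
          (relabel (Equiv.prodUnique a Unit).symm ∘ₗ
            relabel (Equiv.prodUnique a Unit).symm.symm) := rfl
      _ = _ := by
        rw [relabel_comp_relabel, traceLeft_comp_ampliate]
        rfl
  have hle : ∀ v : unitaryGroup b ℂ × unitaryGroup b ℂ, geomCapacity (reducedMap U (t * t)ᵀ)
      ≤ (1 / 2) * diamondNorm (Ad Wᴴ -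
        Ad ((v.1 : Matrix b b ℂ) ⊗ₖ (v.2 : Matrix b b ℂ)) ∘ₗ Ad (swapOp b)) := by
    intro v
    refine (geomCapacity_le _ (huu.Ad v.1.2)).trans
      (mul_le_mul_of_nonneg_left ?_ (by norm_num))
    -- The swap brings the untouched reference to the output B: `v.2` disappears in the partial
    -- trace and `v.1` only rotates the fixed state u².
    have hinit : initMap a ((v.1 : Matrix b b ℂ) * (u * u) * (v.1 : Matrix b b ℂ)ᴴ)
        = traceRight b b ∘ₗ
          (Ad ((v.1 : Matrix b b ℂ) ⊗ₖ (v.2 : Matrix b b ℂ)) ∘ₗ Ad (swapOp b)) ∘ₗ Λ := by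
      ext1 ρ
      simp only [LinearMap.comp_apply]
      rw [traceRight_Ad_kronecker _ v.2.2, traceRight_Ad_swapOp, hΛ, LinearMap.comp_apply,
        traceLeft_traceLeft_probe hu hVc.2, Matrix.mul_smul, Matrix.smul_mul]
      rfl
    rw [hR, hinit, ← LinearMap.comp_sub, ← LinearMap.sub_comp]
    exact diamondNorm_comp_sub_comp_le isChannel_traceRight
      (isChannel_Ad (conjTranspose_mem_unitaryGroup hW)) (isChannel_Ad_comp_Ad_swapOp v) hΛc
  have h2' : 2 * leakage U (t * t)ᵀ ≤ ⨅ v : unitaryGroup b ℂ × unitaryGroup b ℂ,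
      diamondNorm (Ad Wᴴ -
        Ad ((v.1 : Matrix b b ℂ) ⊗ₖ (v.2 : Matrix b b ℂ)) ∘ₗ Ad (swapOp b)) :=
    le_ciInf fun v => by
      have := hle v
      unfold leakage
      linarith
  unfold nonSwappability
  linarith

end Leakage

/-! ### Compactness and nonemptiness of the set of compatible states -/

section Compactness

variable {a b : Type*} [Fintype a] [DecidableEq a] [Fintype b] [DecidableEq b]

theorem isClosed_setOf_posSemidef : IsClosed {M : Matrix a a ℂ | M.PosSemidef} := by
  simp only [posSemidef_iff_dotProduct_mulVec, Set.ofPred_and, Set.ofPred_forall]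
  refine IsClosed.inter ?_ (isClosed_iInter fun x => ?_)
  · exact isClosed_eq (by fun_prop) continuous_id
  · exact isClosed_le continuous_const (by fun_prop)

theorem isClosed_setOf_isState : IsClosed {M : Matrix a a ℂ | IsState M} :=
  isClosed_setOf_posSemidef.inter (isClosed_eq (by fun_prop) continuous_const)

theorem IsState.norm_apply_le {σ : Matrix a a ℂ} (hσ : IsState σ) (i j : a) : ‖σ i j‖ ≤ 1 := by
  have hd : ∀ k, 0 ≤ (σ k k).re ∧ (σ k k).im = 0 := fun k => by
    have := Complex.le_def.mp (hσ.1.diag_nonneg (i := k))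
    exact ⟨this.1, this.2.symm⟩
  have htr : ∑ k, (σ k k).re = 1 := by
    have := congrArg Complex.re hσ.2
    simpa [trace] using this
  have hle : ∀ k, (σ k k).re ≤ 1 := fun k => by
    rw [← htr]
    exact Finset.single_le_sum (f := fun k => (σ k k).re) (fun l _ => (hd l).1)
      (Finset.mem_univ k)
  -- The 2 × 2 minor gives |σᵢⱼ|² ≤ σᵢᵢσⱼⱼ ≤ 1.
  have hdet := (hσ.1.submatrix ![i, j]).det_nonneg
  rw [det_fin_two] at hdet
  simp only [submatrix_apply, cons_val_zero, cons_val_one] at hdet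
  rw [← hσ.1.1.apply j i] at hdet
  have h1 := (Complex.le_def.mp hdet).1
  have h2 : (σ i j * star (σ i j)).re = ‖σ i j‖ ^ 2 := by
    rw [Complex.star_def, Complex.mul_conj, Complex.ofReal_re, Complex.normSq_eq_norm_sq]
  rw [Complex.sub_re, h2, Complex.mul_re, (hd i).2, zero_mul, sub_zero, Complex.zero_re] at h1
  have h3 : (σ i i).re * (σ j j).re ≤ 1 := mul_le_one₀ (hle i) (hd j).1 (hle j)
  nlinarith [norm_nonneg (σ i j)]

theorem isCompact_setOf_isState : IsCompact {M : Matrix a a ℂ | IsState M} := by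
  have hK : IsCompact (Set.univ.pi fun _ : a => Set.univ.pi fun _ : a =>
      Metric.closedBall (0 : ℂ) 1) :=
    isCompact_univ_pi fun _ => isCompact_univ_pi fun _ => isCompact_closedBall 0 1
  refine hK.of_isClosed_subset isClosed_setOf_isState fun σ hσ => ?_
  intro i _ j _
  rw [mem_closedBall_zero_iff]
  exact IsState.norm_apply_le hσ i j

/-- For fixed test data the output is continuous in σ, and positivity and the trace condition are
closed. -/
theorem isClosed_setOf_prepCompatible (W : Matrix (b × b) (b × b) ℂ) :
    IsClosed {σ : Matrix b b ℂ | PrepCompatible W σ} := by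
  have hc : ∀ (m n : ℕ) (N : OpMap (Fin m × b) (Fin n × b))
      (Y : Matrix (Fin m × Unit) (Fin m × Unit) ℂ),
      Continuous fun σ => applyPart (prep σ ∘ₗ genTranspose Wᴴ) N Y := by
    intro m n N Y
    refine continuous_pi fun p => continuous_pi fun q => ?_
    show Continuous fun σ => ∑ i, ∑ j, Y (i, ()) (j, ()) *
      genTranspose Wᴴ (component N i j p.1 q.1) σ p.2 q.2
    refine continuous_finsetSum _ fun i _ => continuous_finsetSum _ fun j _ => ?_
    have hl : Continuous (genTranspose Wᴴ (component N i j p.1 q.1)) :=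
      LinearMap.continuous_of_finiteDimensional _
    exact continuous_const.mul ((continuous_apply q.2).comp ((continuous_apply p.2).comp hl))
  simp only [PrepCompatible, IsSuperchannel, Set.ofPred_forall]
  refine isClosed_iInter fun m => isClosed_iInter fun n => isClosed_iInter fun N =>
    isClosed_iInter fun _ => ?_
  simp only [IsChannel, IsCP, IsTP, Set.ofPred_and, Set.ofPred_forall]
  refine IsClosed.inter (isClosed_iInter fun k => isClosed_iInter fun X =>
    isClosed_iInter fun _ => ?_) (isClosed_iInter fun X => ?_)
  · refine isClosed_setOf_posSemidef.preimage ?_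
    exact continuous_pi fun p => continuous_pi fun q =>
      (continuous_apply q.2).comp ((continuous_apply p.2).comp (hc m n N _))
  · exact isClosed_eq ((hc m n N X).matrix_trace) continuous_const

/-- The maximally mixed state is compatible for every unitary W: its square root is scalar, so it
commutes with W and the probing realization applies with u = t. -/
theorem exists_isState_prepCompatible [Nonempty b] {W : Matrix (b × b) (b × b) ℂ}
    (hW : W ∈ unitaryGroup (b × b) ℂ) : ∃ σ : Matrix b b ℂ, IsState σ ∧ PrepCompatible W σ := by
  have hd0 : (0 : ℝ) < Fintype.card b := by exact_mod_cast Fintype.card_pos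
  set c : ℝ := Real.sqrt (Fintype.card b)⁻¹ with hc
  have hcc : c * c * Fintype.card b = 1 := by
    rw [hc, Real.mul_self_sqrt (inv_nonneg.mpr hd0.le), inv_mul_cancel₀ hd0.ne']
  set t : Matrix b b ℂ := (c : ℂ) • 1 with ht
  have htH : t.IsHermitian := by
    rw [IsHermitian, ht, conjTranspose_smul, conjTranspose_one, Complex.star_def,
      Complex.conj_ofReal]
  have htr : (t * t).trace = 1 := by
    rw [ht, Matrix.smul_mul, Matrix.one_mul, smul_smul, trace_smul, trace_one, smul_eq_mul]
    exact_mod_cast hcc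
  have hk : (1 : Matrix b b ℂ) ⊗ₖ t = (c : ℂ) • (1 : Matrix (b × b) (b × b) ℂ) := by
    rw [ht, kronecker_smul, one_kronecker_one]
  have hpos : (t * t).PosSemidef := by
    have := posSemidef_conjTranspose_mul_self t
    rwa [htH.eq] at this
  refine ⟨(t * t)ᵀ, ⟨hpos.transpose, by rw [trace_transpose, htr]⟩, fun m n N hN => ?_⟩
  rw [applyPart_prep_genTranspose (W := W) htH (by rw [hk, Matrix.mul_smul, Matrix.smul_mul,
    Matrix.mul_one, Matrix.one_mul]) (by rw [hk, Matrix.mul_smul, Matrix.smul_mul, Matrix.mul_one,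
    Matrix.one_mul])]
  exact (isChannel_traceRight.comp
    (isChannel_Ad (conjTranspose_mem_unitaryGroup hW))).ampliate.comp
      ((isChannel_probe htH htr hN).comp (isChannel_relabel _))

end Compactness

/-! ### Continuity of the leakage and existence of the maximum -/

section Continuity

variable {a b r : Type*} [Fintype a] [DecidableEq a] [Fintype b] [DecidableEq b] [Fintype r]
  [DecidableEq r]

/-- The map `ρ ↦ ρ ⊗ σ`. -/
def tensorMap (a : Type*) (σ : Matrix b b ℂ) : OpMap a (a × b) where
  toFun ρ := ρ ⊗ₖ σ
  map_add' X Y := add_kronecker X Y σ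
  map_smul' z X := smul_kronecker z X σ

theorem ampliate_tensorMap (σ : Matrix b b ℂ) (X : Matrix (r × a) (r × a) ℂ) :
    ampliate r (tensorMap a σ) X = relabel (Equiv.prodAssoc r a b).symm (X ⊗ₖ σ) := rfl

theorem isChannel_tensorMap {σ : Matrix b b ℂ} (hσ : IsState σ) :
    IsChannel (tensorMap a σ) := by
  refine ⟨fun n X hX => ?_, fun X => ?_⟩
  · rw [ampliate_tensorMap]
    exact (hX.kronecker hσ.1).submatrix (Equiv.prodAssoc (Fin n) a b).symm
  · exact (trace_kronecker X σ).trans (by rw [hσ.2, mul_one])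

theorem reducedMap_eq_comp (U : OpMap (a × b) (a × b)) (σ : Matrix b b ℂ) :
    reducedMap U σ = traceLeft a b ∘ₗ U ∘ₗ tensorMap a σ := rfl

theorem tensorMap_sub (σ τ : Matrix b b ℂ) :
    tensorMap a (σ - τ) = tensorMap a σ - tensorMap a τ := by
  ext1 ρ
  ext p q
  exact mul_sub _ _ _

theorem reducedMap_sub (U : OpMap (a × b) (a × b)) (σ σ' : Matrix b b ℂ) :
    reducedMap U (σ - σ') = reducedMap U σ - reducedMap U σ' := by
  rw [reducedMap_eq_comp, tensorMap_sub, LinearMap.comp_sub, LinearMap.comp_sub]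
  rfl

theorem traceNorm_ampliate_reducedMap_le {U : OpMap (a × b) (a × b)} (hU : IsChannel U)
    (σ : Matrix b b ℂ) (X : Matrix (r × a) (r × a) ℂ) :
    traceNorm (ampliate r (reducedMap U σ) X) ≤ traceNorm X * traceNorm σ := by
  rw [reducedMap_eq_comp, ← LinearMap.comp_assoc, ampliate_comp, LinearMap.comp_apply,
    ampliate_tensorMap]
  exact ((isChannel_traceLeft.comp hU).ampliate.traceNorm_le _).trans
    (((isChannel_relabel _).traceNorm_le _).trans (traceNorm_kronecker_le _ _))

theorem isChannel_reducedMap {U : OpMap (a × b) (a × b)} (hU : IsChannel U) {σ : Matrix b b ℂ}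
    (hσ : IsState σ) : IsChannel (reducedMap U σ) := by
  rw [reducedMap_eq_comp]
  exact isChannel_traceLeft.comp (hU.comp (isChannel_tensorMap hσ))

theorem diamondNorm_reducedMap_sub_le {U : OpMap (a × b) (a × b)} (hU : IsChannel U)
    (σ : Matrix b b ℂ) {σ' τ : Matrix b b ℂ} (hσ' : IsState σ') (hτ : IsState τ) :
    diamondNorm (reducedMap U σ - initMap a τ)
      ≤ diamondNorm (reducedMap U σ' - initMap a τ) + traceNorm (σ - σ') := by
  refine diamondNorm_le (add_nonneg (diamondNorm_nonneg _) (traceNorm_nonneg _))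
    fun n X hX => ?_
  have e : reducedMap U σ - initMap a τ = (reducedMap U σ' - initMap a τ)
      + reducedMap U (σ - σ') := by
    rw [reducedMap_sub]
    abel
  rw [e, ampliate_add, LinearMap.add_apply]
  exact (traceNorm_add_le _ _).trans (add_le_add
    (traceNorm_ampliate_sub_le_diamondNorm (isChannel_reducedMap hU hσ') (isChannel_initMap hτ) hX)
    ((traceNorm_ampliate_reducedMap_le hU _ X).trans
      (mul_le_of_le_one_left (traceNorm_nonneg _) hX)))

/-- For each fixed target τ the diamond distance changes by at most the trace norm of σ − σ'; this
survives the infimum over τ. -/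
theorem leakage_le_add {U : OpMap (a × b) (a × b)} (hU : IsChannel U) (σ : Matrix b b ℂ)
    {σ' : Matrix b b ℂ} (hσ' : IsState σ') :
    leakage U σ ≤ leakage U σ' + 1 / 2 * traceNorm (σ - σ') := by
  have : Nonempty {τ : Matrix b b ℂ // IsState τ} := ⟨⟨σ', hσ'⟩⟩
  have h : 2 * leakage U σ - traceNorm (σ - σ') ≤ ⨅ τ : {τ : Matrix b b ℂ // IsState τ},
      diamondNorm (reducedMap U σ' - initMap a τ.1) :=
    le_ciInf fun τ => by
      have h1 := diamondNorm_reducedMap_sub_le hU σ hσ' τ.2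
      have h2 := geomCapacity_le (reducedMap U σ) τ.2
      unfold leakage
      linarith
  have h' : leakage U σ' = (1 / 2) * ⨅ τ : {τ : Matrix b b ℂ // IsState τ},
      diamondNorm (reducedMap U σ' - initMap a τ.1) := rfl
  linarith

theorem continuousOn_leakage {U : OpMap (a × b) (a × b)} (hU : IsChannel U) :
    ContinuousOn (leakage U) {σ | IsState σ} := by
  intro σ hσ
  rw [ContinuousWithinAt, tendsto_iff_dist_tendsto_zero]
  have hlim : Filter.Tendsto (fun σ' : Matrix b b ℂ => 1 / 2 * (Fintype.card b *
      Real.sqrt ((σ' - σ)ᴴ * (σ' - σ)).trace.re)) (nhdsWithin σ {σ | IsState σ}) (nhds 0) := by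
    have hcont : Continuous fun σ' : Matrix b b ℂ => 1 / 2 * ((Fintype.card b : ℝ) *
        Real.sqrt ((σ' - σ)ᴴ * (σ' - σ)).trace.re) := by
      fun_prop
    have := hcont.tendsto σ
    simp only [sub_self, trace_zero, Complex.zero_re, Real.sqrt_zero,
      mul_zero] at this
    exact this.mono_left nhdsWithin_le_nhds
  refine squeeze_zero' (Filter.Eventually.of_forall fun _ => dist_nonneg) ?_ hlim
  filter_upwards [self_mem_nhdsWithin] with σ' hσ'
  have h1 := leakage_le_add hU σ' hσ
  have h2 := leakage_le_add hU σ hσ'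
  rw [← neg_sub σ' σ, traceNorm_neg] at h2
  have h3 := traceNorm_le_card_mul_sqrt (σ' - σ)
  rw [Real.dist_eq, abs_le]
  constructor <;> linarith

theorem exists_isGreatest_leakage [Nonempty b] {U : OpMap (a × b) (a × b)} (hU : IsChannel U)
    {W : Matrix (b × b) (b × b) ℂ} (hW : W ∈ unitaryGroup (b × b) ℂ) (hUW : IsCompatible W U) :
    ∃ m : ℝ, IsGreatest {l : ℝ | ∃ σ : Matrix b b ℂ, IsState σ ∧ PrepCompatible W σ ∧
      l = leakage U σ} m ∧ m ≤ nonSwappability (Ad Wᴴ) := by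
  have hK : IsCompact ({σ : Matrix b b ℂ | IsState σ} ∩ {σ | PrepCompatible W σ}) :=
    isCompact_setOf_isState.inter_right (isClosed_setOf_prepCompatible W)
  obtain ⟨σ, ⟨hσ, hWσ⟩, hmax⟩ := hK.exists_isMaxOn (exists_isState_prepCompatible hW)
    ((continuousOn_leakage hU).mono Set.inter_subset_left)
  refine ⟨leakage U σ, ⟨⟨σ, hσ, hWσ, rfl⟩, ?_⟩, leakage_le_nonSwappability hW hUW hσ hWσ⟩
  rintro l ⟨τ, hτ, hWτ, rfl⟩
  exact hmax ⟨hτ, hWτ⟩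

end Continuity

end GenTransp

theorem mainTheorem7 {a b : Type*} [Fintype a] [Fintype b] [DecidableEq a] [DecidableEq b]
    [Nonempty a] [Nonempty b]
    (U : GenTransp.OpMap (a × b) (a × b)) (hU : GenTransp.IsChannel U)
    (W : Matrix (b × b) (b × b) ℂ) (hW : W ∈ Matrix.unitaryGroup (b × b) ℂ) :
    (GenTransp.IsCompatible W U →
      ∃ m : ℝ, IsGreatest {l : ℝ | ∃ σ : Matrix b b ℂ, GenTransp.IsState σ ∧
          GenTransp.PrepCompatible W σ ∧ l = GenTransp.leakage U σ} m ∧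
        m ≤ GenTransp.nonSwappability (GenTransp.Ad W)) ∧
    (GenTransp.IsCompatible Wᴴ U →
      ∃ m : ℝ, IsGreatest {l : ℝ | ∃ σ : Matrix b b ℂ, GenTransp.IsState σ ∧
          GenTransp.PrepCompatible Wᴴ σ ∧ l = GenTransp.leakage U σ} m ∧
        m ≤ GenTransp.nonSwappability (GenTransp.Ad W)) := by
  have hW' := GenTransp.conjTranspose_mem_unitaryGroup hW
  refine ⟨fun h => ?_, fun h => ?_⟩
  -- The argument bounds the leakage by Ξ(Ad_{W†}), which must be turned into Ξ(Ad_W); in the second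
  -- half W† is the input and W†† = W suffices.
  · obtain ⟨m, hm, hle⟩ := GenTransp.exists_isGreatest_leakage hU hW h
    exact ⟨m, hm, hle.trans (GenTransp.nonSwappability_Ad_conjTranspose_le hW)⟩
  · obtain ⟨m, hm, hle⟩ := GenTransp.exists_isGreatest_leakage hU hW' h
    rw [conjTranspose_conjTranspose] at hle
    exact ⟨m, hm, hle⟩
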